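/- Let $X$ be a locally compact Hausdorff space with Borel $\sigma$-algebra $\mathcal B(X)$, let $\mathcal H,\mathcal K$ be Hilbert spaces over $\mathbb F\in\{\mathbb R,\mathbb C\}$ and let $W_1\subseteq B(\mathcal H)$, $W_2\subseteq B(\mathcal K)$ be von Neumann algebras (self-adjoint unital $\mathbb F$-algebras of bounded operators that equal their double commutant). Put $V_j=W_j$ if $\mathbb F=\mathbb C$, and $V_j=(W_j)_h$, the real Banach space of hermitian elements of $W_j$, if $\mathbb F=\mathbb R$. An operator $A$ is positive if it is hermitian and $\langle Ah,h\rangle\ge 0$ for all $h$. $B(V_1,V_2)$ is the space of bounded $\mathbb F$-linear maps $V_1\to V_2$, and $C_0(X,V_1)$ is the space of norm-continuous functions $X\to V_1$ vanishing at infinity, with the supremum norm. A bounded $\mathbb F$-linear map $L:C_0(X,V_1)\to V_2$ is positive if $L(F)$ is positive whenever $F(x)$ is positive for every $x\in X$. A set function $m:\mathcal B(X)\to B(V_1,V_2)$ is a *non-negative measure* if for every positive $A\in V_1$ the set function $m_A(\Delta):=m(\Delta)(A)$ is a positive operator-valued measure (its values are positive operators and it is countably additive in the strong operator topology). It is *regular*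 if for every positive $A\in V_1$ and all $k_1,k_2\in\mathcal K$ the scalar measure $\Delta\mapsto\langle m_A(\Delta)k_1,k_2\rangle$ is regular. Integration with respect to a non-negative measure $m$ is defined as follows. For a positive operator-valued measure $E$ and $k\in\mathcal K$ let $E_k(\Delta)=\langle E(\Delta)k,k\rangle$. A measurable $f:X\to\mathbb F$ is $E$-integrable if there is a constant $C$ with $\int_X|f|\,dE_k\le C\|k\|^2$ for all $k\in\mathcal K$; then $\int_X f\,dE\in B(\mathcal K)$ is the operator $T$ for which $\langle Tk_1,k_2\rangle$ is the form obtained by polarization from $k\mapsto\int_X f\,dE_k$. The function $f$ is $m$-integrable, $f\in\mathcal I(m)$, if it is $m_A$-integrable for every positive $A\in V_1$. For $f\in\mathcal I(m)$ and $A\in V_1$, with $\operatorname{Re}A=\frac12(A+A^*)$ and $\operatorname{Im}A=\frac i2(A^*-A)$, $$\int_X f\,dm_A:=\int_X f\,dm_{(\operatorname{Re}A)_+}-\int_X f\,dm_{(\operatorname{Re}A)_-}+i\int_X f\,dm_{(\operatorname{Im}A)_+}-i\int_X f\,dm_{(\operatorname{Im}A)_-}$$ (if $\mathbb F=\mathbb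 R$, then $A$ is hermitian and only the first two terms occur). For $F=\sum_{i=1}^n f_i\otimes A_i\in\mathcal I(m)\otimes_{\mathbb F}V_1$, put $\int_X F\,dm:=\sum_{i=1}^n\int_X f_i\,dm_{A_i}$, and for a uniform limit $F$ of elements $F_i$ of $\mathcal I(m)\otimes_{\mathbb F}V_1$, put $\int_X F\,dm:=\lim_i\int_X F_i\,dm$ in operator norm. **Theorem.** 1. ($\mathbb F=\mathbb R$) For every positive bounded linear map $L:C_0(X,(W_1)_h)\to(W_2)_h$ there exists a unique regular non-negative measure $m:\mathcal B(X)\to B((W_1)_h,(W_2)_h)$ such that every $F\in C_0(X,(W_1)_h)$ is a uniform limit as above and $L(F)=\int_X F\,dm$. 2. ($\mathbb F=\mathbb C$) For every positive bounded linear map $L:C_0(X,W_1)\to W_2$ there exists a unique regular non-negative measure $m:\mathcal B(X)\to B(W_1,W_2)$ such that every $F\in C_0(X,W_1)$ is a uniform limit as above and $L(F)=\int_X F\,dm$. -/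

import Mathlib

open scoped ZeroAtInfty
open MeasureTheory Filter Topology

/-- A von Neumann algebra on a real Hilbert space `H`: a (unital) star-subalgebra of the bounded
operators on `H` that equals its double commutant. The complex case is Mathlib's
`VonNeumannAlgebra`. -/
structure RealVonNeumannAlgebra (H : Type*) [NormedAddCommGroup H] [InnerProductSpace ℝ H]
    [CompleteSpace H] extends StarSubalgebra ℝ (H →L[ℝ] H) where
  /-- The algebra is its own double commutant. -/
  centralizer_centralizer' : Set.centralizer (Set.centralizer carrier) = carrier

/-- The real Banach space `W_h` of hermitian elements of a real von Neumann algebra `W`. -/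
noncomputable def RealVonNeumannAlgebra.hermitian {H : Type*} [NormedAddCommGroup H] [InnerProductSpace ℝ H]
    [CompleteSpace H] (W : RealVonNeumannAlgebra H) : Submodule ℝ (H →L[ℝ] H) :=
  Subalgebra.toSubmodule W.toStarSubalgebra.toSubalgebra ⊓ selfAdjoint.submodule ℝ (H →L[ℝ] H)

/-- A complex von Neumann algebra as a (closed) linear subspace of the bounded operators. -/
noncomputable def VonNeumannAlgebra.space {H : Type*} [NormedAddCommGroup H] [InnerProductSpace ℂ H]
    [CompleteSpace H] (W : VonNeumannAlgebra H) : Submodule ℂ (H →L[ℂ] H) :=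
  Subalgebra.toSubmodule W.toStarSubalgebra.toSubalgebra

/-- The sigma-algebra of a measurable space, as a type. -/
abbrev MeasSet (X : Type*) [MeasurableSpace X] : Type _ := {s : Set X // MeasurableSet s}

namespace OperatorMeasure

section POVM

variable {𝕜 X K : Type*} [RCLike 𝕜] [MeasurableSpace X]
  [NormedAddCommGroup K] [InnerProductSpace 𝕜 K]

/-- `E` is a positive operator-valued measure: its values are positive operators and it is
countably additive in the strong operator topology. (Taking all sets empty gives `E ∅ = 0`.) -/
structure IsPOVM (E : MeasSet X → (K →L[𝕜] K)) : Prop where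
  isPositive : ∀ Δ, (E Δ).IsPositive
  hasSum : ∀ Δ : ℕ → MeasSet X, Pairwise (fun i j => Disjoint (Δ i : Set X) (Δ j : Set X)) →
    ∀ k : K, HasSum (fun n => E (Δ n) k)
      (E ⟨⋃ n, (Δ n : Set X), MeasurableSet.iUnion fun n => (Δ n).2⟩ k)

theorem IsPOVM.apply_empty {E : MeasSet X → (K →L[𝕜] K)} (hE : IsPOVM E) (k : K) :
    E ⟨∅, MeasurableSet.empty⟩ k = 0 := by
  have h := hE.hasSum (fun _ => ⟨∅, MeasurableSet.empty⟩) (fun i j _ => by simp) k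
  exact (summable_const_iff _).1 h.summable

theorem IsPOVM.inner_nonneg {E : MeasSet X → (K →L[𝕜] K)} (hE : IsPOVM E) (Δ : MeasSet X)
    (k : K) : 0 ≤ RCLike.re (inner 𝕜 k (E Δ k)) :=
  (hE.isPositive Δ).re_inner_nonneg_right k

/-- The finite positive measure `E_k`, `Δ ↦ ⟨E(Δ) k, k⟩`. -/
noncomputable def IsPOVM.quadMeasure {E : MeasSet X → (K →L[𝕜] K)} (hE : IsPOVM E) (k : K) :
    Measure X :=
  Measure.ofMeasurable (fun s hs => ENNReal.ofReal (RCLike.re (inner 𝕜 k (E ⟨s, hs⟩ k))))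
    (by rw [hE.apply_empty k]; simp)
    (by
      intro f hf hd
      have h := hE.hasSum (fun n => ⟨f n, hf n⟩) hd k
      have h2 : HasSum (fun n => RCLike.re (inner 𝕜 k (E ⟨f n, hf n⟩ k)))
          (RCLike.re (inner 𝕜 k (E ⟨⋃ n, f n, MeasurableSet.iUnion hf⟩ k))) :=
        RCLike.hasSum_re 𝕜 ((innerSL 𝕜 k).hasSum h)
      rw [← h2.tsum_eq]
      exact ENNReal.ofReal_tsum_of_nonneg (fun n => hE.inner_nonneg _ k) h2.summable)

theorem IsPOVM.quadMeasure_apply {E : MeasSet X → (K →L[𝕜] K)} (hE : IsPOVM E) (k : K)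
    (Δ : MeasSet X) :
    hE.quadMeasure k Δ = ENNReal.ofReal (RCLike.re (inner 𝕜 k (E Δ k))) :=
  Measure.ofMeasurable_apply _ Δ.2

/-- A measurable scalar function `f` is `E`-integrable if `∫ |f| dE_k ≤ C ‖k‖²` for all `k`. -/
def IsPOVM.Integrable {E : MeasSet X → (K →L[𝕜] K)} (hE : IsPOVM E) (f : X → 𝕜) : Prop :=
  Measurable f ∧ ∃ C : ℝ, ∀ k : K,
    ∫⁻ x, ENNReal.ofReal ‖f x‖ ∂(hE.quadMeasure k) ≤ ENNReal.ofReal (C * ‖k‖ ^ 2)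

/-- `f` is `E`-integrable and `T = ∫ f dE`, that is, `⟨T k₁, k₂⟩` is the form obtained by
polarization from `k ↦ ∫ f dE_k`. For `𝕜 = ℝ` one has `RCLike.I = 0` and only the first
two terms are left, which is real polarization. (In Mathlib, `inner` is conjugate-linear in its
first argument.) -/
def IsPOVM.HasIntegral {E : MeasSet X → (K →L[𝕜] K)} (hE : IsPOVM E) (f : X → 𝕜)
    (T : K →L[𝕜] K) : Prop :=
  hE.Integrable f ∧ ∀ k₁ k₂ : K,
    inner 𝕜 k₂ (T k₁) = (1 / 4 : 𝕜) *
      (((∫ x, f x ∂(hE.quadMeasure (k₁ + k₂))) - ∫ x, f x ∂(hE.quadMeasure (k₁ - k₂)))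
        + (RCLike.I : 𝕜) * ((∫ x, f x ∂(hE.quadMeasure (k₁ + (RCLike.I : 𝕜) • k₂)))
            - ∫ x, f x ∂(hE.quadMeasure (k₁ - (RCLike.I : 𝕜) • k₂))))

end POVM

section NonnegMeasure

variable {𝕜 X H K : Type*} [RCLike 𝕜] [MeasurableSpace X]
  [NormedAddCommGroup H] [InnerProductSpace 𝕜 H] [CompleteSpace H]
  [NormedAddCommGroup K] [InnerProductSpace 𝕜 K] [CompleteSpace K]
  {V₁ : Submodule 𝕜 (H →L[𝕜] H)} {V₂ : Submodule 𝕜 (K →L[𝕜] K)}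

/-- The set function `m_A`, `Δ ↦ m(Δ)(A)`, with values regarded as operators on `K`. -/
def eval (m : MeasSet X → (V₁ →L[𝕜] V₂)) (A : V₁) : MeasSet X → (K →L[𝕜] K) :=
  fun Δ => ((m Δ A : V₂) : K →L[𝕜] K)

/-- `m` is a non-negative measure: `m_A` is a positive operator-valued measure for every positive
`A`. It is used with `V₁ = W₁`, `V₂ = W₂` over `ℂ` and with the hermitian parts of `W₁`, `W₂`
over `ℝ`. -/
def IsNonnegMeasure (m : MeasSet X → (V₁ →L[𝕜] V₂)) : Prop :=
  ∀ A : V₁, (A : H →L[𝕜] H).IsPositive → IsPOVM (eval m A)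

/-- `f` is `m`-integrable: it is `m_A`-integrable for every positive `A`. -/
def IsNonnegMeasure.Integrable {m : MeasSet X → (V₁ →L[𝕜] V₂)} (hm : IsNonnegMeasure m)
    (f : X → 𝕜) : Prop :=
  ∀ (A : V₁) (hA : (A : H →L[𝕜] H).IsPositive), (hm A hA).Integrable f

/-- `P` and `N` are the positive and the negative part of the hermitian operator `A`: they are
positive, `A = P - N` and `P N = 0` (these properties determine `P` and `N`). -/
structure IsJordanParts (A P N : H →L[𝕜] H) : Prop where
  pos : P.IsPositive
  neg : N.IsPositive
  sub_eq : A = P - N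
  mul_eq_zero : P * N = 0

/-- `f` is `m`-integrable and `T = ∫ f dm_A` for a general operator `A`, where
`∫ f dm_A = ∫ f dm_{Re(A)₊} - ∫ f dm_{Re(A)₋} + i ∫ f dm_{Im(A)₊} - i ∫ f dm_{Im(A)₋}`
with `Re A = (A + A⋆) / 2`, `Im A = i (A⋆ - A) / 2`. For `𝕜 = ℝ` and `A` hermitian, `Re A = A`,
`RCLike.I = 0` and `Im A = 0`. -/
def IsNonnegMeasure.HasIntegralOn {m : MeasSet X → (V₁ →L[𝕜] V₂)} (hm : IsNonnegMeasure m)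
    (f : X → 𝕜) (A : V₁) (T : K →L[𝕜] K) : Prop :=
  hm.Integrable f ∧
  ∃ (P N Q R : V₁)
    (hre : IsJordanParts ((1 / 2 : 𝕜) • ((A : H →L[𝕜] H) + star (A : H →L[𝕜] H)))
      (P : H →L[𝕜] H) (N : H →L[𝕜] H))
    (him : IsJordanParts ((RCLike.I / 2 : 𝕜) • (star (A : H →L[𝕜] H) - (A : H →L[𝕜] H)))
      (Q : H →L[𝕜] H) (R : H →L[𝕜] H))
    (TP TN TQ TR : K →L[𝕜] K),
    (hm P hre.pos).HasIntegral f TP ∧ (hm N hre.neg).HasIntegral f TN ∧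
    (hm Q him.pos).HasIntegral f TQ ∧ (hm R him.neg).HasIntegral f TR ∧
    T = TP - TN + (RCLike.I : 𝕜) • TQ - (RCLike.I : 𝕜) • TR

/-- `F = ∑ fᵢ ⊗ Aᵢ` (a function `X → V₁`) lies in the algebraic tensor product of the
`m`-integrable functions with `V₁`, and `T = ∫ F dm = ∑ ∫ fᵢ dm_{Aᵢ}`. -/
def IsNonnegMeasure.HasTensorIntegral {m : MeasSet X → (V₁ →L[𝕜] V₂)} (hm : IsNonnegMeasure m)
    (F : X → V₁) (T : K →L[𝕜] K) : Prop :=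
  ∃ (n : ℕ) (f : Fin n → X → 𝕜) (A : Fin n → V₁) (S : Fin n → (K →L[𝕜] K)),
    (∀ x, F x = ∑ i, f i x • A i) ∧ (∀ i, hm.HasIntegralOn (f i) (A i) (S i)) ∧ T = ∑ i, S i

/-- `F` is a uniform limit of elements `Fᵢ` of the algebraic tensor product, and
`T = ∫ F dm = lim ∫ Fᵢ dm` (limit in the operator norm). -/
def IsNonnegMeasure.HasIntegral {m : MeasSet X → (V₁ →L[𝕜] V₂)} (hm : IsNonnegMeasure m)
    (F : X → V₁) (T : K →L[𝕜] K) : Prop :=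
  ∃ (G : ℕ → X → V₁) (S : ℕ → (K →L[𝕜] K)),
    (∀ i, hm.HasTensorIntegral (G i) (S i)) ∧ TendstoUniformly G F atTop ∧
      Tendsto S atTop (𝓝 T)

/-- A scalar set function `ν` on the Borel sets is regular: every Borel set `Δ` lies between a
compact set `C` and an open set `U` such that `ν` is small on all Borel subsets of `U \ C`. -/
def IsRegularSetFunction [TopologicalSpace X] (ν : MeasSet X → 𝕜) : Prop :=
  ∀ (Δ : MeasSet X) (ε : ℝ), 0 < ε → ∃ C U : Set X, IsCompact C ∧ IsOpen U ∧
    C ⊆ (Δ : Set X) ∧ (Δ : Set X) ⊆ U ∧ ∀ Γ : MeasSet X, (Γ : Set X) ⊆ U \ C → ‖ν Γ‖ < ε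

/-- `m` is regular: `Δ ↦ ⟨m_A(Δ) k₁, k₂⟩` is regular for every positive `A` and all `k₁, k₂`. -/
def IsRegular [TopologicalSpace X] (m : MeasSet X → (V₁ →L[𝕜] V₂)) : Prop :=
  ∀ A : V₁, (A : H →L[𝕜] H).IsPositive → ∀ k₁ k₂ : K,
    IsRegularSetFunction (fun Δ => inner 𝕜 k₂ (eval m A Δ k₁))

/-- A bounded linear map `L : C₀(X, V₁) → V₂` is positive if it maps functions with positive
values to positive operators. -/
def IsPositiveMap [TopologicalSpace X] (L : C₀(X, V₁) →L[𝕜] V₂) : Prop :=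
  ∀ F : C₀(X, V₁), (∀ x, (F x : H →L[𝕜] H).IsPositive) → (L F : K →L[𝕜] K).IsPositive

/-- `m` is a regular non-negative measure with `L(F) = ∫ F dm` for all `F` in `C₀(X, V₁)`. -/
def IsRepresentingMeasure [TopologicalSpace X] (L : C₀(X, V₁) →L[𝕜] V₂)
    (m : MeasSet X → (V₁ →L[𝕜] V₂)) : Prop :=
  IsRegular m ∧ ∃ hm : IsNonnegMeasure m,
    ∀ F : C₀(X, V₁), hm.HasIntegral F (L F : K →L[𝕜] K)

end NonnegMeasure

end OperatorMeasure

/-! Both scalar fields are treated at once, for subspaces `V₁`, `V₂` of operators subject to two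
conditions: `V₁` contains the identity and the Jordan parts of its elements (`HasJordanParts`), and
`V₂` is closed under weak operator limits (`IsWeaklyClosed`). Both follow from the double commutant
property. The Jordan parts come from an absolute value built by an iteration that works over ℝ and ℂ
alike.

Existence. For positive `A` and a vector `k`, the functional `f ↦ ⟨L(f ⊗ A)k, k⟩` on `C_c(X, ℝ)` is
positive and bounded, so the Riesz theorem represents it by a finite regular measure. The operator
`m(Δ)(A)` is the weak limit of `L(f ⊗ A)` along one filter (`approxFilter`) on which `f` tends to
the indicator of `Δ` in `L¹(ν)` for all finite regular `ν` simultaneously. Limits exist by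
polarization and Jordan decomposition. Since the filter depends on neither `A` nor the vectors,
linearity, boundedness, positivity and membership in `V₂` pass to the limit
(`exists_isLimitMeasure`). Cauchy–Schwarz upgrades weak to strong countable additivity
(`isPOVM_of_measure`). The measures `⟨m_A(·)k, k⟩` are the Riesz measures, so `L` and integration
agree on elementary tensors, and the density of their sums gives the rest.

Uniqueness. The integral of `F` is a limit along some unspecified sequence of tensors of integrable
functions, possibly discontinuous. The estimate `|⟨(∫ G dm)k, k⟩| ≤ 2 sup‖G‖ ⟨m(X)(1)k, k⟩`, from
`IsNonnegMeasure.norm_sum_integral_le`, makes the limit independent of that sequence. Hence `L`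
determines `∫ f d⟨m_A(·)k, k⟩` for all `f` in `C_c`, and regularity determines the measure. -/

namespace OperatorMeasure

/-! ### Positive operators, absolute values and Jordan parts. -/

section Operators

variable {𝕜 H : Type*} [RCLike 𝕜] [NormedAddCommGroup H] [InnerProductSpace 𝕜 H]

/-- The Cauchy–Schwarz inequality for the form of a positive operator. -/
theorem norm_inner_sq_le_of_isPositive {T : H →L[𝕜] H} (hT : T.IsPositive) (x y : H) :
    ‖inner 𝕜 y (T x)‖ ^ 2 ≤ RCLike.re (inner 𝕜 x (T x)) * RCLike.re (inner 𝕜 y (T y)) := by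
  let c : PreInnerProductSpace.Core 𝕜 H :=
    { inner := fun x y => inner 𝕜 x (T y)
      conj_inner_symm := fun x y => by
        rw [inner_conj_symm]; exact hT.inner_left_eq_inner_right x y
      re_inner_nonneg := fun x => hT.re_inner_nonneg_right x
      add_left := fun x y z => inner_add_left _ _ _
      smul_left := fun x y r => inner_smul_left _ _ _ }
  have h := @InnerProductSpace.Core.inner_mul_inner_self_le 𝕜 H _ _ _ c y x
  change ‖inner 𝕜 y (T x)‖ * ‖inner 𝕜 x (T y)‖
    ≤ RCLike.re (inner 𝕜 y (T y)) * RCLike.re (inner 𝕜 x (T x)) at h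
  have h2 : ‖inner 𝕜 x (T y)‖ = ‖inner 𝕜 y (T x)‖ := by
    rw [← hT.inner_left_eq_inner_right x y, norm_inner_symm]
  rw [h2] at h
  nlinarith

/-- Cauchy–Schwarz with `y = T x`, cancelling one factor `‖T x‖²`. A small quadratic form thus
forces a small vector, which is what turns weak convergence of positive operators into strong
convergence. -/
theorem norm_apply_sq_le_of_isPositive {T : H →L[𝕜] H} (hT : T.IsPositive) {M : ℝ}
    (hM : ∀ y, RCLike.re (inner 𝕜 y (T y)) ≤ M * ‖y‖ ^ 2) (x : H) :
    ‖T x‖ ^ 2 ≤ M * RCLike.re (inner 𝕜 x (T x)) := by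
  have h := norm_inner_sq_le_of_isPositive hT x (T x)
  rw [inner_self_eq_norm_sq_to_K] at h
  have h1 : ‖((‖T x‖ : 𝕜)) ^ 2‖ ^ 2 = ‖T x‖ ^ 2 * ‖T x‖ ^ 2 := by simp; ring
  rw [h1] at h
  have h0 := hT.re_inner_nonneg_right x
  have h2 := mul_le_mul_of_nonneg_left (hM (T x)) h0
  rcases eq_or_lt_of_le (sq_nonneg ‖T x‖) with h3 | h3
  -- Here `T x = 0` and nothing can be cancelled; the right side is nonnegative because the
  -- hypothesis forces `M ≥ 0` unless `x = 0`.
  · rw [← h3]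
    rcases eq_or_lt_of_le (norm_nonneg x) with hx | hx
    · have : x = 0 := norm_eq_zero.1 hx.symm
      simp [this]
    · have := (hT.re_inner_nonneg_right x).trans (hM x)
      exact mul_nonneg (nonneg_of_mul_nonneg_left this (by positivity)) h0
  · nlinarith

/-- Square roots of elements within distance one of the identity, as limits of the iteration
`Y ↦ (S + Y ^ 2) / 2`. -/
theorem exists_mul_self_eq_one_sub {𝕜 R : Type*} [RCLike 𝕜] [NormedRing R] [NormedAlgebra 𝕜 R]
    [CompleteSpace R] (S : R) (hS : ‖S‖ ≤ 1) :
    ∃ Y : R, ‖Y‖ ≤ 1 ∧ (1 - Y) * (1 - Y) = 1 - S ∧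
      ∀ V : Set R, IsClosed V → 0 ∈ V → (∀ Z ∈ V, (1 / 2 : 𝕜) • (S + Z * Z) ∈ V) → Y ∈ V := by
  let Y : ℕ → R := fun n => Nat.rec 0 (fun _ Z => (1 / 2 : 𝕜) • (S + Z * Z)) n
  -- Scalar majorant: the same iteration with `S` replaced by 1. It increases, stays below 1 and
  -- dominates the increments of `Y`, which makes `Y` Cauchy although the iteration need not be a
  -- contraction when `‖S‖ = 1`.
  let y : ℕ → ℝ := fun n => Nat.rec 0 (fun _ z => (1 / 2 : ℝ) * (1 + z * z)) n
  have Y0 : Y 0 = 0 := rfl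
  have y0 : y 0 = 0 := rfl
  have Ys : ∀ n, Y (n + 1) = (1 / 2 : 𝕜) • (S + Y n * Y n) := fun n => rfl
  have ys : ∀ n, y (n + 1) = (1 / 2 : ℝ) * (1 + y n * y n) := fun n => rfl
  have hhalf : ‖(1 / 2 : 𝕜)‖ = 1 / 2 := by simp
  have hy : ∀ n, 0 ≤ y n ∧ y n ≤ 1 := by
    intro n
    induction n with
    | zero => simp [y0]
    | succ n ih => rw [ys]; constructor <;> nlinarith [ih.1, ih.2]
  have hY : ∀ n, ‖Y n‖ ≤ y n := by
    intro n
    induction n with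
    | zero => simp [y0, Y0]
    | succ n ih =>
      rw [ys, Ys, norm_smul, hhalf]
      gcongr
      refine (norm_add_le _ _).trans (add_le_add hS ((norm_mul_le _ _).trans ?_))
      gcongr
      exact (hy n).1
  have hd : ∀ n, ‖Y (n + 1) - Y n‖ ≤ y (n + 1) - y n := by
    intro n
    induction n with
    | zero =>
      rw [Ys, ys, Y0, y0]
      simp only [mul_zero, add_zero, sub_zero, norm_smul, hhalf]
      linarith
    | succ n ih =>
      have e : Y (n + 1 + 1) - Y (n + 1) = (1 / 2 : 𝕜) •
          (Y (n + 1) * (Y (n + 1) - Y n) + (Y (n + 1) - Y n) * Y n) := by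
        rw [Ys (n + 1), Ys n, ← smul_sub, ← Ys n]
        congr 1
        noncomm_ring
      have e2 : y (n + 1 + 1) - y (n + 1) = (1 / 2 : ℝ) *
          (y (n + 1) * (y (n + 1) - y n) + (y (n + 1) - y n) * y n) := by
        rw [ys (n + 1), ys n, ← ys n]
        ring
      rw [e, e2, norm_smul, hhalf]
      gcongr
      refine (norm_add_le _ _).trans (add_le_add ((norm_mul_le _ _).trans ?_)
        ((norm_mul_le _ _).trans ?_))
      · exact mul_le_mul (hY (n + 1)) ih (norm_nonneg _) (hy (n + 1)).1
      · exact mul_le_mul ih (hY n) (norm_nonneg _) ((norm_nonneg _).trans ih)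
  have hmono : Monotone y :=
    monotone_nat_of_le_succ fun n => by linarith [(norm_nonneg _).trans (hd n)]
  have hylim : Tendsto y atTop (𝓝 (⨆ n, y n)) :=
    tendsto_atTop_ciSup hmono ⟨1, by rintro _ ⟨n, rfl⟩; exact (hy n).2⟩
  have hdist : ∀ n m, n ≤ m → ‖Y m - Y n‖ ≤ y m - y n := by
    intro n m h
    induction m, h using Nat.le_induction with
    | base => simp
    | succ m _ ih =>
      have : Y (m + 1) - Y n = (Y (m + 1) - Y m) + (Y m - Y n) := by abel
      rw [this]
      linarith [norm_add_le (Y (m + 1) - Y m) (Y m - Y n), hd m]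
  have hc : CauchySeq Y := by
    rw [Metric.cauchySeq_iff']
    intro ε hε
    obtain ⟨N, hN⟩ := Metric.cauchySeq_iff'.1 hylim.cauchySeq ε hε
    refine ⟨N, fun n hn => ?_⟩
    rw [dist_eq_norm]
    refine (hdist N n hn).trans_lt ((le_abs_self _).trans_lt ?_)
    simpa [Real.dist_eq] using hN n hn
  obtain ⟨Z, hZ⟩ := cauchySeq_tendsto_of_complete hc
  refine ⟨Z, le_of_tendsto hZ.norm (Eventually.of_forall fun n => (hY n).trans (hy n).2), ?_, ?_⟩
  · have h1 : Tendsto (fun n => Y (n + 1)) atTop (𝓝 ((1 / 2 : 𝕜) • (S + Z * Z))) := by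
      simp only [Ys]
      exact (tendsto_const_nhds.add (hZ.mul hZ)).const_smul _
    have h2 := tendsto_nhds_unique h1 (hZ.comp (tendsto_add_atTop_nat 1))
    have h3 : S + Z * Z = (2 : 𝕜) • Z := by
      have := congrArg (fun W => (2 : 𝕜) • W) h2
      simp only [smul_smul] at this
      rw [← this]; norm_num
    have h4 : (1 - Z) * (1 - Z) = 1 - (2 : 𝕜) • Z + Z * Z := by
      rw [ofNat_smul_eq_nsmul 𝕜 2 Z]
      noncomm_ring
    rw [h4, ← h3]
    abel
  · intro V hV h0 hstep
    refine hV.mem_of_tendsto hZ (Eventually.of_forall fun n => ?_)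
    induction n with
    | zero => exact h0
    | succ n ih => rw [Ys]; exact hstep _ ih

variable [CompleteSpace H]

theorem isSelfAdjoint_algebraMap_smul {T : H →L[𝕜] H} (hT : IsSelfAdjoint T) (c : ℝ) :
    IsSelfAdjoint ((c : 𝕜) • T) := by
  rw [isSelfAdjoint_iff, star_smul, hT.star_eq]
  simp

theorem inner_mul_self_apply {A : H →L[𝕜] H} (hA : IsSelfAdjoint A) (x y : H) :
    inner 𝕜 x ((A * A) y) = inner 𝕜 (A x) (A y) :=
  (hA.isSymmetric x (A y)).symm

/-- The absolute value of a hermitian operator. -/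
theorem exists_isPositive_mul_self_eq {A : H →L[𝕜] H} (hA : IsSelfAdjoint A) :
    ∃ R : H →L[𝕜] H, R.IsPositive ∧ R * R = A * A ∧ ∀ B, Commute A B → Commute R B := by
  rcases eq_or_ne A 0 with rfl | hA0
  · exact ⟨0, ContinuousLinearMap.isPositive_zero, rfl, fun B _ => Commute.zero_left B⟩
  have hc : 0 < ‖A‖ := norm_pos_iff.2 hA0
  set c := ‖A‖ with hcdef
  -- Scaled so that `0 ≤ S ≤ 1`. Then `1 - S = A² / c²` has the square root `1 - Y`, and `c (1 - Y)`
  -- is the absolute value, positive because `‖Y‖ ≤ 1`.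
  set S : H →L[𝕜] H := 1 - (((c ^ 2)⁻¹ : ℝ) : 𝕜) • (A * A) with hSdef
  have hSform : ∀ x, RCLike.re (inner 𝕜 x (S x)) = ‖x‖ ^ 2 - (c ^ 2)⁻¹ * ‖A x‖ ^ 2 := by
    intro x
    rw [hSdef, sub_apply, smul_apply, inner_sub_right,
      inner_smul_right, inner_mul_self_apply hA, map_sub, RCLike.re_ofReal_mul,
      ← norm_sq_eq_re_inner (𝕜 := 𝕜) (A x)]
    congr 1
    exact (norm_sq_eq_re_inner (𝕜 := 𝕜) x).symm
  have hAA : IsSelfAdjoint (A * A) := by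
    rw [isSelfAdjoint_iff, star_mul, hA.star_eq]
  have hSsa : IsSelfAdjoint S := (IsSelfAdjoint.one _).sub (isSelfAdjoint_algebraMap_smul hAA _)
  have hSpos : S.IsPositive := by
    rw [ContinuousLinearMap.isPositive_def']
    refine ⟨hSsa, fun x => ?_⟩
    rw [ContinuousLinearMap.reApplyInnerSelf_apply, inner_re_symm, hSform]
    have : ‖A x‖ ^ 2 ≤ c ^ 2 * ‖x‖ ^ 2 := by
      rw [← mul_pow]; exact pow_le_pow_left₀ (norm_nonneg _) (A.le_opNorm x) 2
    have h3 := mul_le_mul_of_nonneg_left this (inv_nonneg.2 (sq_nonneg c))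
    rw [inv_mul_cancel_left₀ (by positivity)] at h3
    linarith
  have hSle : ∀ x, RCLike.re (inner 𝕜 x (S x)) ≤ 1 * ‖x‖ ^ 2 := by
    intro x
    rw [hSform, one_mul]
    have : 0 ≤ (c ^ 2)⁻¹ * ‖A x‖ ^ 2 := by positivity
    linarith
  have hSn : ‖S‖ ≤ 1 := by
    refine ContinuousLinearMap.opNorm_le_bound _ zero_le_one fun x => ?_
    have h1 := norm_apply_sq_le_of_isPositive hSpos hSle x
    have h2 := hSle x
    rw [one_mul] at *
    exact le_of_sq_le_sq (h1.trans (by simpa using h2)) (norm_nonneg _)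
  obtain ⟨Y, hY1, hY2, hY3⟩ := exists_mul_self_eq_one_sub (𝕜 := 𝕜) S hSn
  have hYsa : IsSelfAdjoint Y := by
    refine hY3 {Z | IsSelfAdjoint Z} ?_ (IsSelfAdjoint.zero _) fun Z hZ => ?_
    · exact isClosed_eq continuous_star continuous_id
    · have h : IsSelfAdjoint (Z * Z) := by
        rw [isSelfAdjoint_iff, star_mul, IsSelfAdjoint.star_eq hZ]
      have := isSelfAdjoint_algebraMap_smul (𝕜 := 𝕜) (hSsa.add h) (1 / 2)
      rw [RCLike.ofReal_div, RCLike.ofReal_one, RCLike.ofReal_ofNat] at this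
      exact this
  have hYcomm : ∀ B, Commute A B → Commute Y B := by
    intro B hB
    have hSB : Commute S B :=
      (Commute.one_left B).sub_left (Commute.smul_left (hB.mul_left hB) _)
    refine hY3 {Z | Commute Z B} ?_ (Commute.zero_left B) fun Z hZ => ?_
    · exact isClosed_eq (continuous_id.mul continuous_const) (continuous_const.mul continuous_id)
    · exact Commute.smul_left (hSB.add_left (Commute.mul_left hZ hZ)) _
  refine ⟨(c : 𝕜) • (1 - Y), ?_, ?_, fun B hB => ?_⟩
  · rw [ContinuousLinearMap.isPositive_def']
    refine ⟨isSelfAdjoint_algebraMap_smul ((IsSelfAdjoint.one _).sub hYsa) c, fun x => ?_⟩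
    rw [ContinuousLinearMap.reApplyInnerSelf_apply, inner_re_symm,
      smul_apply, inner_smul_right, RCLike.re_ofReal_mul,
      sub_apply, inner_sub_right, map_sub]
    refine mul_nonneg hc.le ?_
    have h1 : RCLike.re (inner 𝕜 x (Y x)) ≤ ‖x‖ ^ 2 := by
      refine (re_inner_le_norm x (Y x)).trans ?_
      have := Y.le_of_opNorm_le hY1 x
      nlinarith [norm_nonneg x]
    have h2 : RCLike.re (inner 𝕜 x ((1 : H →L[𝕜] H) x)) = ‖x‖ ^ 2 :=
      (norm_sq_eq_re_inner (𝕜 := 𝕜) x).symm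
    linarith
  · rw [smul_mul_smul_comm, hY2, hSdef, sub_sub_cancel, smul_smul, ← RCLike.ofReal_mul,
      ← RCLike.ofReal_mul]
    have : c * c * (c ^ 2)⁻¹ = 1 := by field_simp
    rw [this]
    simp
  · exact Commute.smul_left ((Commute.one_left B).sub_left (hYcomm B hB)) _

/-- With `D = R + A` one has `D² = 2RD`, hence `2⟨D R x, R x⟩ = ⟨R D x, D x⟩ ≥ 0`, so `D` is
positive on the closure of the range of `R`. On the orthogonal complement `ker R` it vanishes, since
`‖A v‖ = ‖R v‖`. -/
theorem isPositive_add_of_mul_self_eq {R A : H →L[𝕜] H} (hR : R.IsPositive)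
    (hA : IsSelfAdjoint A) (hRA : Commute R A) (h : R * R = A * A) : (R + A).IsPositive := by
  set D := R + A with hD
  have hDsa : IsSelfAdjoint D := hR.isSelfAdjoint.add hA
  have hDD : D * D = (2 : 𝕜) • (R * D) := by
    rw [hD, ofNat_smul_eq_nsmul 𝕜 2, mul_add, add_mul, add_mul, mul_add, ← h, ← hRA.eq]
    abel
  have hRD : Commute R D := (Commute.refl R).add_right hRA
  have key : ∀ x, 0 ≤ RCLike.re (inner 𝕜 (R x) (D (R x))) := by
    intro x
    have e : (2 : 𝕜) * inner 𝕜 (R x) (D (R x)) = 2 * inner 𝕜 (R x) ((R * D) x) := by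
      rw [hRD.eq]; rfl
    have e2 : (2 : 𝕜) * inner 𝕜 (R x) (D (R x)) = inner 𝕜 (D x) (R (D x)) := by
      rw [e, ← inner_smul_right]
      change inner 𝕜 (R x) (((2 : 𝕜) • (R * D)) x) = _
      rw [← hDD]
      rw [mul_apply_eq_comp, ← hDsa.isSymmetric.apply_clm]
      have : D (R x) = R (D x) := by
        change (D * R) x = (R * D) x
        rw [hRD.eq]
      rw [this, hR.inner_left_eq_inner_right]
    have e3 := congrArg RCLike.re e2
    have := hR.re_inner_nonneg_right (D x)
    rw [← e3] at this
    have h3 : RCLike.re ((2 : 𝕜) * inner 𝕜 (R x) (D (R x)))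
        = 2 * RCLike.re (inner 𝕜 (R x) (D (R x))) := by
      simp
    linarith
  have key2 : ∀ u ∈ closure (Set.range R), 0 ≤ RCLike.re (inner 𝕜 u (D u)) := by
    intro u hu
    have hcl : IsClosed {u | 0 ≤ RCLike.re (inner 𝕜 u (D u))} :=
      isClosed_le continuous_const (by fun_prop)
    exact closure_minimal (by rintro _ ⟨x, rfl⟩; exact key x) hcl hu
  have hker : ∀ v, R v = 0 → D v = 0 := by
    intro v hv
    have : ‖A v‖ ^ 2 = 0 := by
      rw [norm_sq_eq_re_inner (𝕜 := 𝕜) (A v), ← inner_mul_self_apply hA, ← h,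
        inner_mul_self_apply hR.isSelfAdjoint, hv]
      simp
    have : A v = 0 := by simpa using this
    rw [hD, add_apply, hv, this, add_zero]
  rw [ContinuousLinearMap.isPositive_def']
  refine ⟨hDsa, fun y => ?_⟩
  rw [ContinuousLinearMap.reApplyInnerSelf_apply, inner_re_symm]
  have : CompleteSpace R.ker := R.isClosed_ker.completeSpace_coe
  obtain ⟨v, hv, u, hu, rfl⟩ := R.ker.exists_add_mem_mem_orthogonal y
  have hv0 : D v = 0 := hker v hv
  have hu' : u ∈ closure (Set.range R) := by
    rw [ContinuousLinearMap.orthogonal_ker, hR.isSelfAdjoint.adjoint_eq] at hu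
    exact hu
  have h1 : inner 𝕜 v (D u) = 0 := by
    rw [← hDsa.isSymmetric.apply_clm, hv0, inner_zero_left]
  rw [map_add, hv0, zero_add, inner_add_left, h1, zero_add]
  exact key2 u hu'

open scoped ComplexOrder in
/-- A hermitian operator has Jordan parts, and they commute with whatever it commutes with. -/
theorem exists_isJordanParts {A : H →L[𝕜] H} (hA : IsSelfAdjoint A) :
    ∃ P N : H →L[𝕜] H, IsJordanParts A P N ∧
      ∀ B, Commute A B → Commute P B ∧ Commute N B := by
  obtain ⟨R, hR, hRR, hcomm⟩ := exists_isPositive_mul_self_eq hA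
  have hRA : Commute R A := hcomm A (Commute.refl A)
  have hhalf : (0 : 𝕜) ≤ 1 / 2 := by
    simp
  have h1 := isPositive_add_of_mul_self_eq hR hA hRA hRR
  have h2 : (R - A).IsPositive := by
    rw [sub_eq_add_neg]
    exact isPositive_add_of_mul_self_eq hR hA.neg hRA.neg_right (by rw [neg_mul_neg, hRR])
  refine ⟨(1 / 2 : 𝕜) • (R + A), (1 / 2 : 𝕜) • (R - A), ⟨h1.smul_of_nonneg hhalf,
    h2.smul_of_nonneg hhalf, ?_, ?_⟩, fun B hB => ⟨?_, ?_⟩⟩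
  · rw [← smul_sub]
    have : R + A - (R - A) = (2 : 𝕜) • A := by rw [two_smul]; abel
    rw [this, smul_smul]; norm_num
  · rw [smul_mul_smul_comm, add_mul, mul_sub, mul_sub, hRR, hRA.eq]
    simp
  · exact Commute.smul_left ((hcomm B hB).add_left hB) _
  · exact Commute.smul_left ((hcomm B hB).sub_left hB) _

end Operators

open scoped CompactlySupported

/-! ### Weak operator limits. -/

section WeakLimits

variable {𝕜 H : Type*} [RCLike 𝕜] [NormedAddCommGroup H] [InnerProductSpace 𝕜 H]
  [CompleteSpace H]

/-- Bounded families of operators whose matrix elements converge have a weak operator limit. -/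
theorem exists_weak_limit {ι : Type*} {l : Filter ι} [l.NeBot] {T : ι → (H →L[𝕜] H)} {C : ℝ}
    (hT : ∀ᶠ i in l, ‖T i‖ ≤ C)
    (hlim : ∀ x y : H, ∃ z, Tendsto (fun i => inner 𝕜 y (T i x)) l (𝓝 z)) :
    ∃ S : H →L[𝕜] H, ‖S‖ ≤ C ∧
      ∀ x y, Tendsto (fun i => inner 𝕜 y (T i x)) l (𝓝 (inner 𝕜 y (S x))) := by
  choose b hb using hlim
  have hC : 0 ≤ C := by
    obtain ⟨i, hi⟩ := hT.exists
    exact (norm_nonneg _).trans hi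
  have hbound : ∀ y x, ‖b x y‖ ≤ C * ‖y‖ * ‖x‖ := by
    intro y x
    refine le_of_tendsto (hb x y).norm (hT.mono fun i hi => ?_)
    refine (norm_inner_le_norm _ _).trans ?_
    have := (T i).le_of_opNorm_le hi x
    nlinarith [norm_nonneg y, mul_le_mul_of_nonneg_left this (norm_nonneg y)]
  let f : H →ₗ⋆[𝕜] H →ₗ[𝕜] 𝕜 := LinearMap.mk₂'ₛₗ (starRingEnd 𝕜) (RingHom.id 𝕜)
    (fun y x => b x y)
    (fun y₁ y₂ x => tendsto_nhds_unique (hb x (y₁ + y₂)) (by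
      simpa only [inner_add_left] using (hb x y₁).add (hb x y₂)))
    (fun c y x => tendsto_nhds_unique (hb x (c • y)) (by
      simpa only [inner_smul_left, smul_eq_mul] using
        (hb x y).const_mul (starRingEnd 𝕜 c)))
    (fun y x₁ x₂ => tendsto_nhds_unique (hb (x₁ + x₂) y) (by
      simpa only [map_add, inner_add_right] using (hb x₁ y).add (hb x₂ y)))
    (fun c y x => by
      refine tendsto_nhds_unique (hb (c • x) y) ?_
      simpa only [map_smul, inner_smul_right, smul_eq_mul, RingHom.id_apply] using
        (hb x y).const_mul c)
  let B : H →L⋆[𝕜] H →L[𝕜] 𝕜 := f.mkContinuous₂ C hbound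
  let S : H →L[𝕜] H := ContinuousLinearMap.adjoint (InnerProductSpace.continuousLinearMapOfBilin B)
  have hS : ∀ x y, inner 𝕜 y (S x) = b x y := by
    intro x y
    rw [ContinuousLinearMap.adjoint_inner_right,
      InnerProductSpace.continuousLinearMapOfBilin_apply]
    rfl
  refine ⟨S, ?_, fun x y => by rw [hS]; exact hb x y⟩
  refine ContinuousLinearMap.opNorm_le_of_re_inner_le hC fun x y hx hy => ?_
  rw [← inner_re_symm, hS]
  refine (RCLike.re_le_norm _).trans ((hbound y x).trans_eq (by rw [hx, hy]; ring))

/-- A set of operators containing all its weak operator limits. -/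
def IsWeaklyClosed (V : Set (H →L[𝕜] H)) : Prop :=
  ∀ (l : Filter (H →L[𝕜] H)) [l.NeBot] (T : H →L[𝕜] H), (∀ᶠ S in l, S ∈ V) →
    (∀ x y, Tendsto (fun S : H →L[𝕜] H => inner 𝕜 y (S x)) l (𝓝 (inner 𝕜 y (T x)))) → T ∈ V

/-- The matrix elements of `S B` and `B S` at `(x, y)` are those of `S` at `(B x, y)` and `(x, B*
y)`, so commuting with `B` survives weak limits. A double commutant is a centralizer, hence weakly
closed. -/
theorem isWeaklyClosed_centralizer (s : Set (H →L[𝕜] H)) :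
    IsWeaklyClosed (Set.centralizer s) := by
  intro l _ T hl hT
  rw [Set.mem_centralizer_iff]
  intro B hB
  ext x
  refine ext_inner_left 𝕜 fun y => ?_
  have h1 := hT (B x) y
  have h2 := hT x (ContinuousLinearMap.adjoint B y)
  simp only [ContinuousLinearMap.adjoint_inner_left] at h2
  refine tendsto_nhds_unique h2 (h1.congr' (hl.mono fun S hS => ?_))
  rw [Set.mem_centralizer_iff] at hS
  exact congrArg (fun W : H →L[𝕜] H => inner 𝕜 y (W x)) (hS B hB).symm

theorem isWeaklyClosed_isSelfAdjoint :
    IsWeaklyClosed {T : H →L[𝕜] H | IsSelfAdjoint T} := by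
  intro l _ T hl hT
  rw [Set.mem_ofPred_eq, ContinuousLinearMap.isSelfAdjoint_iff_isSymmetric]
  intro x y
  have h1 : Tendsto (fun S : H →L[𝕜] H => inner 𝕜 (S x) y) l (𝓝 (inner 𝕜 (T x) y)) := by
    have := (RCLike.continuous_conj (K := 𝕜)).continuousAt.tendsto.comp (hT x y)
    simpa only [Function.comp_def, inner_conj_symm] using this
  refine tendsto_nhds_unique h1 ((hT y x).congr' (hl.mono fun S hS => ?_))
  exact ((ContinuousLinearMap.isSelfAdjoint_iff_isSymmetric.1 hS) x y).symm

omit [CompleteSpace H] in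
theorem IsWeaklyClosed.inter {V W : Set (H →L[𝕜] H)} (hV : IsWeaklyClosed V)
    (hW : IsWeaklyClosed W) : IsWeaklyClosed (V ∩ W) := fun l _ T hl hT =>
  ⟨hV l T (hl.mono fun _ h => h.1) hT, hW l T (hl.mono fun _ h => h.2) hT⟩

theorem isWeaklyClosed_isPositive : IsWeaklyClosed {T : H →L[𝕜] H | T.IsPositive} := by
  intro l _ T hl hT
  rw [Set.mem_ofPred_eq, ContinuousLinearMap.isPositive_def']
  refine ⟨isWeaklyClosed_isSelfAdjoint l T (hl.mono fun S hS => hS.isSelfAdjoint) hT,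
    fun x => ?_⟩
  rw [ContinuousLinearMap.reApplyInnerSelf_apply, inner_re_symm]
  exact ge_of_tendsto ((RCLike.continuous_re.tendsto _).comp (hT x x))
    (hl.mono fun S hS => hS.re_inner_nonneg_right x)

/-- A space of operators that contains the identity and in which every element is a combination
of the positive and negative parts of its real and imaginary parts. -/
structure HasJordanParts (V : Submodule 𝕜 (H →L[𝕜] H)) : Prop where
  one_mem : (1 : H →L[𝕜] H) ∈ V
  exists_parts : ∀ A : V, ∃ P N Q R : V,
    IsJordanParts ((1 / 2 : 𝕜) • ((A : H →L[𝕜] H) + star (A : H →L[𝕜] H)))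
      (P : H →L[𝕜] H) (N : H →L[𝕜] H) ∧
    IsJordanParts ((RCLike.I / 2 : 𝕜) • (star (A : H →L[𝕜] H) - (A : H →L[𝕜] H)))
      (Q : H →L[𝕜] H) (R : H →L[𝕜] H) ∧
    A = P - N + (RCLike.I : 𝕜) • Q - (RCLike.I : 𝕜) • R

end WeakLimits

/-! ### Von Neumann algebras satisfy the two abstract conditions. -/

section VonNeumann

theorem isWeaklyClosed_hermitian {H : Type*} [NormedAddCommGroup H]
    [InnerProductSpace ℝ H] [CompleteSpace H] (W : RealVonNeumannAlgebra H) :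
    IsWeaklyClosed (W.hermitian : Set (H →L[ℝ] H)) := by
  have h := (isWeaklyClosed_centralizer (Set.centralizer W.carrier)).inter
    (isWeaklyClosed_isSelfAdjoint (𝕜 := ℝ) (H := H))
  rw [W.centralizer_centralizer'] at h
  exact h

theorem isWeaklyClosed_space {H : Type*} [NormedAddCommGroup H]
    [InnerProductSpace ℂ H] [CompleteSpace H] (W : VonNeumannAlgebra H) :
    IsWeaklyClosed (W.space : Set (H →L[ℂ] H)) := by
  have h := isWeaklyClosed_centralizer (Set.centralizer W.carrier)
  rw [W.centralizer_centralizer'] at h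
  exact h

/-- The Jordan parts commute with everything that commutes with `A`, so they lie in the double
commutant. Over ℝ the imaginary part is zero and `Q = R = 0` serve. -/
theorem hasJordanParts_hermitian {H : Type*} [NormedAddCommGroup H]
    [InnerProductSpace ℝ H] [CompleteSpace H] (W : RealVonNeumannAlgebra H) :
    HasJordanParts W.hermitian := by
  refine ⟨⟨W.toStarSubalgebra.one_mem, IsSelfAdjoint.one _⟩, fun A => ?_⟩
  have hA : IsSelfAdjoint (A : H →L[ℝ] H) := A.2.2
  have hAW : (A : H →L[ℝ] H) ∈ W.carrier := A.2.1
  obtain ⟨P, N, hPN, hc⟩ := exists_isJordanParts hA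
  have hmem : ∀ T : H →L[ℝ] H, (∀ B, Commute (A : H →L[ℝ] H) B → Commute T B) →
      T ∈ W.carrier := by
    intro T hT
    rw [← W.centralizer_centralizer', Set.mem_centralizer_iff]
    intro B hB
    exact (hT B (Set.mem_centralizer_iff.1 hB _ hAW)).eq.symm
  refine ⟨⟨P, hmem P fun B hB => (hc B hB).1, hPN.pos.isSelfAdjoint⟩,
    ⟨N, hmem N fun B hB => (hc B hB).2, hPN.neg.isSelfAdjoint⟩, 0, 0, ?_, ?_, ?_⟩
  · rw [hA.star_eq, ← two_smul ℝ (A : H →L[ℝ] H), smul_smul]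
    simpa using hPN
  · rw [hA.star_eq, sub_self, smul_zero]
    exact ⟨ContinuousLinearMap.isPositive_zero, ContinuousLinearMap.isPositive_zero,
      by simp, by simp⟩
  · refine Subtype.ext ?_
    change (A : H →L[ℝ] H) = P - N + (RCLike.I : ℝ) • (0 : H →L[ℝ] H)
      - (RCLike.I : ℝ) • (0 : H →L[ℝ] H)
    rw [smul_zero, add_zero, sub_zero]
    exact hPN.sub_eq

theorem hasJordanParts_space {H : Type*} [NormedAddCommGroup H]
    [InnerProductSpace ℂ H] [CompleteSpace H] (W : VonNeumannAlgebra H) :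
    HasJordanParts W.space := by
  refine ⟨W.toStarSubalgebra.one_mem, ?_⟩
  rintro ⟨a, haW⟩
  have hAW : a ∈ W.toStarSubalgebra := haW
  have hsW : star a ∈ W.toStarSubalgebra := star_mem hAW
  have hmem : ∀ S : H →L[ℂ] H, S ∈ W.toStarSubalgebra → ∀ T : H →L[ℂ] H,
      (∀ B, Commute S B → Commute T B) → T ∈ W.carrier := by
    intro S hS T hT
    rw [← W.centralizer_centralizer', Set.mem_centralizer_iff]
    intro B hB
    exact (hT B (Set.mem_centralizer_iff.1 hB _ hS)).eq.symm
  have hre : IsSelfAdjoint ((1 / 2 : ℂ) • (a + star a)) := by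
    rw [isSelfAdjoint_iff, star_smul, star_add, star_star, add_comm]
    simp
  have him : IsSelfAdjoint ((RCLike.I / 2 : ℂ) • (star a - a)) := by
    rw [isSelfAdjoint_iff, star_smul, star_sub, star_star, ← neg_sub (star a) a, smul_neg,
      ← neg_smul]
    congr 1
    simp [neg_div]
  have hreW : (1 / 2 : ℂ) • (a + star a) ∈ W.toStarSubalgebra :=
    W.toStarSubalgebra.toSubalgebra.smul_mem (add_mem hAW hsW) _
  have himW : (RCLike.I / 2 : ℂ) • (star a - a) ∈ W.toStarSubalgebra :=
    W.toStarSubalgebra.toSubalgebra.smul_mem (sub_mem hsW hAW) _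
  obtain ⟨P, N, hPN, hc⟩ := exists_isJordanParts hre
  obtain ⟨Q, R, hQR, hd⟩ := exists_isJordanParts him
  refine ⟨⟨P, hmem _ hreW P fun B hB => (hc B hB).1⟩, ⟨N, hmem _ hreW N fun B hB => (hc B hB).2⟩,
    ⟨Q, hmem _ himW Q fun B hB => (hd B hB).1⟩, ⟨R, hmem _ himW R fun B hB => (hd B hB).2⟩,
    hPN, hQR, ?_⟩
  refine Subtype.ext ?_
  change a = P - N + (RCLike.I : ℂ) • Q - (RCLike.I : ℂ) • R
  rw [add_sub_assoc, ← smul_sub, ← hPN.sub_eq, ← hQR.sub_eq, smul_smul]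
  have : (RCLike.I * (RCLike.I / 2) : ℂ) = -(1 / 2) := by
    rw [← mul_div_assoc, show (RCLike.I : ℂ) = Complex.I from rfl, Complex.I_mul_I]; ring
  rw [this]
  module

end VonNeumann

/-! ### Approximating indicators by compactly supported functions; Riesz measures. -/

section Approximation

variable {X : Type*} [TopologicalSpace X] [MeasurableSpace X]

/-- Every Borel set lies between a compact and an open set whose difference has small measure. -/
def IsCompactOpenRegular (ν : Measure X) : Prop :=
  ∀ Δ : Set X, MeasurableSet Δ → ∀ ε : ℝ, 0 < ε → ∃ C U : Set X, IsCompact C ∧ IsOpen U ∧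
    C ⊆ Δ ∧ Δ ⊆ U ∧ ν.real (U \ C) < ε

theorem isCompactOpenRegular_zero : IsCompactOpenRegular (0 : Measure X) := fun Δ _ ε hε =>
  ⟨∅, Set.univ, isCompact_empty, isOpen_univ, Set.empty_subset _, Set.subset_univ _, by simpa⟩

theorem IsCompactOpenRegular.add {ν₁ ν₂ : Measure X} [IsFiniteMeasure ν₁] [IsFiniteMeasure ν₂]
    (h₁ : IsCompactOpenRegular ν₁) (h₂ : IsCompactOpenRegular ν₂) :
    IsCompactOpenRegular (ν₁ + ν₂) := by
  intro Δ hΔ ε hε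
  obtain ⟨C₁, U₁, hC₁, hU₁, hs₁, ht₁, hlt₁⟩ := h₁ Δ hΔ (ε / 2) (half_pos hε)
  obtain ⟨C₂, U₂, hC₂, hU₂, hs₂, ht₂, hlt₂⟩ := h₂ Δ hΔ (ε / 2) (half_pos hε)
  refine ⟨C₁ ∪ C₂, U₁ ∩ U₂, hC₁.union hC₂, hU₁.inter hU₂, Set.union_subset hs₁ hs₂,
    Set.subset_inter ht₁ ht₂, ?_⟩
  rw [measureReal_add_apply]
  have e₁ : ν₁.real ((U₁ ∩ U₂) \ (C₁ ∪ C₂)) ≤ ν₁.real (U₁ \ C₁) :=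
    measureReal_mono (Set.sdiff_subset_sdiff Set.inter_subset_left Set.subset_union_left)
  have e₂ : ν₂.real ((U₁ ∩ U₂) \ (C₁ ∪ C₂)) ≤ ν₂.real (U₂ \ C₂) :=
    measureReal_mono (Set.sdiff_subset_sdiff Set.inter_subset_right Set.subset_union_right)
  linarith

theorem integrable_compactlySupported [OpensMeasurableSpace X] (ν : Measure X) [IsFiniteMeasure ν]
    (f : C_c(X, ℝ)) : Integrable f ν := by
  obtain ⟨C, hC⟩ := f.hasCompactSupport.exists_bound_of_continuous f.continuous
  exact Integrable.of_bound f.continuous.aestronglyMeasurable C (Eventually.of_forall hC)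

variable [T2Space X] [BorelSpace X]

theorem isCompactOpenRegular_of_regular (ν : Measure X) [IsFiniteMeasure ν] [ν.Regular] :
    IsCompactOpenRegular ν := by
  intro Δ hΔ ε hε
  have hε' : ENNReal.ofReal (ε / 2) ≠ 0 := by simpa using half_pos hε
  obtain ⟨U, hΔU, hU, -, hU2⟩ := hΔ.exists_isOpen_sdiff_lt (measure_ne_top ν Δ) hε'
  obtain ⟨C, hCΔ, hC, hC2⟩ := hΔ.exists_isCompact_sdiff_lt (measure_ne_top ν Δ) hε'
  refine ⟨C, U, hC, hU, hCΔ, hΔU, ?_⟩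
  have e : U \ C ⊆ (U \ Δ) ∪ (Δ \ C) := by
    intro x hx
    by_cases h : x ∈ Δ
    · exact Or.inr ⟨h, hx.2⟩
    · exact Or.inl ⟨hx.1, h⟩
  have e1 : ν.real (U \ Δ) < ε / 2 := by
    rw [measureReal_def]
    exact (ENNReal.lt_ofReal_iff_toReal_lt (measure_ne_top _ _)).1 hU2
  have e2 : ν.real (Δ \ C) < ε / 2 := by
    rw [measureReal_def]
    exact (ENNReal.lt_ofReal_iff_toReal_lt (measure_ne_top _ _)).1 hC2
  linarith [measureReal_mono (μ := ν) e, measureReal_union_le (μ := ν) (U \ Δ) (Δ \ C)]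

omit [T2Space X] in
theorem IsCompactOpenRegular.regular {ν : Measure X} [IsFiniteMeasure ν]
    (h : IsCompactOpenRegular ν) : ν.Regular := by
  refine { lt_top_of_isCompact := fun K _ => measure_lt_top ν K, outerRegular := ?_,
           innerRegular := ?_ }
  · intro Δ hΔ r hr
    obtain ⟨r', hr', hr'r⟩ := exists_between hr
    have hr'top : r' ≠ ⊤ := hr'r.ne_top
    have hε : 0 < r'.toReal - ν.real Δ := by
      rw [sub_pos, measureReal_def]
      exact (ENNReal.toReal_lt_toReal (measure_ne_top _ _) hr'top).2 hr'
    obtain ⟨C, U, hC, hU, hCΔ, hΔU, hlt⟩ := h Δ hΔ _ hε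
    refine ⟨U, hΔU, hU, lt_of_le_of_lt ?_ hr'r⟩
    rw [← ENNReal.toReal_le_toReal (measure_ne_top _ _) hr'top, ← measureReal_def]
    have e1 : U ⊆ Δ ∪ (U \ C) := fun x hx => by
      by_cases hxC : x ∈ C
      · exact Or.inl (hCΔ hxC)
      · exact Or.inr ⟨hx, hxC⟩
    linarith [measureReal_mono (μ := ν) e1, measureReal_union_le (μ := ν) Δ (U \ C)]
  · intro U hU r hr
    have hrtop : r ≠ ⊤ := hr.ne_top
    have hε : 0 < ν.real U - r.toReal := by
      rw [sub_pos, measureReal_def]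
      exact (ENNReal.toReal_lt_toReal hrtop (measure_ne_top _ _)).2 hr
    obtain ⟨C, U', hC, hU', hCΔ, hΔU, hlt⟩ := h U hU.measurableSet _ hε
    refine ⟨C, hCΔ, hC, ?_⟩
    rw [← ENNReal.toReal_lt_toReal hrtop (measure_ne_top _ _), ← measureReal_def]
    have e1 : U ⊆ C ∪ (U' \ C) := fun x hx => by
      by_cases hxC : x ∈ C
      · exact Or.inl hxC
      · exact Or.inr ⟨hΔU hx, hxC⟩
    linarith [measureReal_mono (μ := ν) e1, measureReal_union_le (μ := ν) C (U' \ C)]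

variable [LocallyCompactSpace X]

/-- The functions `0 ≤ f ≤ 1` in `C_c(X, ℝ)` that are close to the indicator of `Δ` in `L¹(ν)`. -/
def approxSet (Δ : Set X) (ν : Measure X) (ε : ℝ) : Set C_c(X, ℝ) :=
  {f | (∀ x, 0 ≤ f x ∧ f x ≤ 1) ∧ ∫ x, |f x - Δ.indicator 1 x| ∂ν < ε}

/-- The filter on `C_c(X, ℝ)` of simultaneous approximation of the indicator of `Δ` with respect to
all finite regular measures. -/
def approxFilter (Δ : Set X) : Filter C_c(X, ℝ) :=
  ⨅ p : {p : Measure X × ℝ // IsFiniteMeasure p.1 ∧ IsCompactOpenRegular p.1 ∧ 0 < p.2},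
    𝓟 (approxSet Δ p.1.1 p.1.2)

omit [T2Space X] [LocallyCompactSpace X] in
theorem integrable_sub_indicator (ν : Measure X) [IsFiniteMeasure ν] {Δ : Set X}
    (hΔ : MeasurableSet Δ) (f : C_c(X, ℝ)) :
    Integrable (fun x => f x - Δ.indicator 1 x) ν :=
  (integrable_compactlySupported ν f).sub ((integrable_const (1 : ℝ)).indicator hΔ)

/-- A Urysohn function `f` for `C ⊆ U` satisfies `|f - 1_Δ| ≤ 1_{U \ C}`. -/
theorem approxSet_nonempty {Δ : Set X} (hΔ : MeasurableSet Δ) (ν : Measure X) [IsFiniteMeasure ν]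
    (hν : IsCompactOpenRegular ν) {ε : ℝ} (hε : 0 < ε) : (approxSet Δ ν ε).Nonempty := by
  obtain ⟨C, U, hC, hU, hCΔ, hΔU, hlt⟩ := hν Δ hΔ ε hε
  obtain ⟨f, hf1, hf2, hf3, hf4⟩ :=
    exists_continuousMap_one_of_isCompact_subset_isOpen hC hU (hCΔ.trans hΔU)
  let g : C_c(X, ℝ) := ⟨f, hf2⟩
  refine ⟨g, hf4, lt_of_le_of_lt ?_ hlt⟩
  have hm : MeasurableSet (U \ C) := hU.measurableSet.diff hC.measurableSet
  rw [← integral_indicator_one hm]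
  refine integral_mono (integrable_sub_indicator ν hΔ g).abs
    ((integrable_const (1 : ℝ)).indicator hm) fun x => ?_
  change |f x - Δ.indicator 1 x| ≤ (U \ C).indicator 1 x
  by_cases hxC : x ∈ C
  · rw [hf1 hxC, Set.indicator_of_mem (hCΔ hxC), Set.indicator_of_notMem (fun h => h.2 hxC)]
    simp
  · by_cases hxU : x ∈ U
    · have hx : x ∈ U \ C := ⟨hxU, hxC⟩
      rw [Set.indicator_of_mem hx]
      have h := hf4 x
      rw [abs_le]
      by_cases hxΔ : x ∈ Δ
      · rw [Set.indicator_of_mem hxΔ]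
        constructor <;> simp only [Pi.one_apply] <;> linarith [h.1, h.2]
      · rw [Set.indicator_of_notMem hxΔ]
        constructor <;> simp only [Pi.one_apply] <;> linarith [h.1, h.2]
    · have h0 : f x = 0 := image_eq_zero_of_notMem_tsupport fun h => hxU (hf3 h)
      rw [h0, Set.indicator_of_notMem (fun h => hxU (hΔU h)),
        Set.indicator_of_notMem (fun h => hxU h.1)]
      simp

/-- The family is directed: approximation in `L¹(ν₁ + ν₂)` within `min ε₁ ε₂` implies both given
approximations. -/
theorem approxFilter_neBot {Δ : Set X} (hΔ : MeasurableSet Δ) : (approxFilter Δ).NeBot := by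
  have : Nonempty {p : Measure X × ℝ //
      IsFiniteMeasure p.1 ∧ IsCompactOpenRegular p.1 ∧ 0 < p.2} :=
    ⟨(0, 1), by infer_instance, isCompactOpenRegular_zero, one_pos⟩
  refine iInf_neBot_of_directed' ?_ ?_
  · rintro ⟨⟨ν₁, ε₁⟩, hf₁, hr₁, hε₁⟩ ⟨⟨ν₂, ε₂⟩, hf₂, hr₂, hε₂⟩
    dsimp only at hf₁ hr₁ hε₁ hf₂ hr₂ hε₂
    refine ⟨⟨(ν₁ + ν₂, min ε₁ ε₂), by infer_instance, hr₁.add hr₂, lt_min hε₁ hε₂⟩, ?_, ?_⟩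
    · refine principal_mono.2 fun f hf => ⟨hf.1, ?_⟩
      have h := hf.2
      dsimp only at h ⊢
      rw [integral_add_measure (integrable_sub_indicator ν₁ hΔ f).abs
        (integrable_sub_indicator ν₂ hΔ f).abs] at h
      have : 0 ≤ ∫ x, |f x - Δ.indicator 1 x| ∂ν₂ := integral_nonneg fun _ => abs_nonneg _
      linarith [min_le_left ε₁ ε₂]
    · refine principal_mono.2 fun f hf => ⟨hf.1, ?_⟩
      have h := hf.2
      dsimp only at h ⊢
      rw [integral_add_measure (integrable_sub_indicator ν₁ hΔ f).abs
        (integrable_sub_indicator ν₂ hΔ f).abs] at h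
      have : 0 ≤ ∫ x, |f x - Δ.indicator 1 x| ∂ν₁ := integral_nonneg fun _ => abs_nonneg _
      linarith [min_le_right ε₁ ε₂]
  · rintro ⟨⟨ν, ε⟩, hf, hr, hε⟩
    exact principal_neBot_iff.2 (approxSet_nonempty hΔ ν hr hε)

omit [T2Space X] [BorelSpace X] [LocallyCompactSpace X] in
theorem approxSet_mem_approxFilter (Δ : Set X) (ν : Measure X) [hf : IsFiniteMeasure ν]
    (hν : IsCompactOpenRegular ν) {ε : ℝ} (hε : 0 < ε) : approxSet Δ ν ε ∈ approxFilter Δ :=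
  mem_iInf_of_mem ⟨(ν, ε), hf, hν, hε⟩ (mem_principal_self _)

omit [T2Space X] [BorelSpace X] [LocallyCompactSpace X] in
theorem eventually_approxFilter (Δ : Set X) :
    ∀ᶠ f in approxFilter Δ, ∀ x, 0 ≤ f x ∧ f x ≤ 1 :=
  mem_of_superset (approxSet_mem_approxFilter Δ 0 isCompactOpenRegular_zero one_pos)
    fun _ hf => hf.1

omit [T2Space X] [LocallyCompactSpace X] in
theorem tendsto_integral_approxFilter {Δ : Set X} (hΔ : MeasurableSet Δ) (ν : Measure X)
    [IsFiniteMeasure ν] (hν : IsCompactOpenRegular ν) :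
    Tendsto (fun f : C_c(X, ℝ) => ∫ x, f x ∂ν) (approxFilter Δ) (𝓝 (ν.real Δ)) := by
  rw [Metric.tendsto_nhds]
  intro ε hε
  refine mem_of_superset (approxSet_mem_approxFilter Δ ν hν hε) fun f hf => ?_
  change dist (∫ x, f x ∂ν) (ν.real Δ) < ε
  have e := integral_sub (integrable_compactlySupported ν f)
    ((integrable_const (1 : ℝ)).indicator (μ := ν) hΔ)
  rw [Real.dist_eq, ← integral_indicator_one hΔ]
  refine (congrArg abs e).symm.trans_lt ?_
  exact (abs_integral_le_integral_abs).trans_lt hf.2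

/-- The Riesz representation theorem for a bounded positive functional on `C_c(X, ℝ)`. -/
theorem exists_measure_of_positive (Λ : C_c(X, ℝ) →ₗ[ℝ] ℝ) (hΛ : ∀ f, (∀ x, 0 ≤ f x) → 0 ≤ Λ f)
    (C : ℝ) (hC : ∀ f : C_c(X, ℝ), (∀ x, 0 ≤ f x ∧ f x ≤ 1) → Λ f ≤ C) :
    ∃ μ : Measure X, IsFiniteMeasure μ ∧ IsCompactOpenRegular μ ∧
      ∀ f : C_c(X, ℝ), ∫ x, f x ∂μ = Λ f := by
  let Λ' : C_c(X, ℝ) →ₚ[ℝ] ℝ := PositiveLinearMap.mk₀ Λ fun f hf => hΛ f fun x => hf x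
  have hfin : IsFiniteMeasure (RealRMK.rieszMeasure Λ') := by
    -- By inner regularity the total mass is a supremum over compact sets, and a Urysohn function
    -- bounds each of their measures by `C`.
    refine ⟨lt_of_le_of_lt ?_ (ENNReal.ofReal_lt_top (r := C))⟩
    rw [isOpen_univ.measure_eq_iSup_isCompact]
    refine iSup₂_le fun K _ => iSup_le fun hK => ?_
    obtain ⟨f, hf1, hf2, hf3, hf4⟩ :=
      exists_continuousMap_one_of_isCompact_subset_isOpen hK isOpen_univ (Set.subset_univ K)
    let g : C_c(X, ℝ) := ⟨f, hf2⟩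
    refine (RealRMK.rieszMeasure_le_of_eq_one Λ' (f := g) (fun x => (hf4 x).1) hK
      fun x hx => hf1 hx).trans (ENNReal.ofReal_le_ofReal (hC g hf4))
  exact ⟨RealRMK.rieszMeasure Λ', hfin, isCompactOpenRegular_of_regular _,
    fun f => RealRMK.integral_rieszMeasure Λ' f⟩

end Approximation

/-! ### Elementary tensors. -/

section Tensor

variable {𝕜 X E : Type*} [RCLike 𝕜] [TopologicalSpace X] [NormedAddCommGroup E] [NormedSpace 𝕜 E]

/-- The elementary tensor `f ⊗ A`, `x ↦ f(x) A`. -/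
noncomputable def tensor (𝕜 : Type*) [RCLike 𝕜] [NormedSpace 𝕜 E] (f : C_c(X, ℝ)) (A : E) :
    C₀(X, E) where
  toFun x := ((f x : ℝ) : 𝕜) • A
  continuous_toFun := by
    have := f.continuous
    fun_prop
  zero_at_infty' := by
    have h : HasCompactSupport fun x => ((f x : ℝ) : 𝕜) • A :=
      f.hasCompactSupport.comp_left (g := fun r : ℝ => (r : 𝕜) • A) (by simp)
    exact h.is_zero_at_infty

theorem tensor_apply (f : C_c(X, ℝ)) (A : E) (x : X) : tensor 𝕜 f A x = ((f x : ℝ) : 𝕜) • A :=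
  rfl

theorem tensor_add_left (f g : C_c(X, ℝ)) (A : E) :
    tensor 𝕜 (f + g) A = tensor 𝕜 f A + tensor 𝕜 g A := by
  ext x
  simp [tensor_apply, add_smul]

theorem tensor_sub_left (f g : C_c(X, ℝ)) (A : E) :
    tensor 𝕜 (f - g) A = tensor 𝕜 f A - tensor 𝕜 g A := by
  ext x
  simp [tensor_apply, sub_smul]

theorem tensor_smul_left (c : ℝ) (f : C_c(X, ℝ)) (A : E) :
    tensor 𝕜 (c • f) A = (c : 𝕜) • tensor 𝕜 f A := by
  ext x
  simp [tensor_apply, mul_smul]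

theorem tensor_add_right (f : C_c(X, ℝ)) (A B : E) :
    tensor 𝕜 f (A + B) = tensor 𝕜 f A + tensor 𝕜 f B := by
  ext x
  simp [tensor_apply]

theorem tensor_sub_right (f : C_c(X, ℝ)) (A B : E) :
    tensor 𝕜 f (A - B) = tensor 𝕜 f A - tensor 𝕜 f B := by
  ext x
  simp [tensor_apply, smul_sub]

theorem tensor_smul_right (f : C_c(X, ℝ)) (c : 𝕜) (A : E) :
    tensor 𝕜 f (c • A) = c • tensor 𝕜 f A := by
  ext x
  simp [tensor_apply, smul_comm c]

theorem norm_zeroAtInfty_le {F : C₀(X, E)} {C : ℝ} (hC : 0 ≤ C) (h : ∀ x, ‖F x‖ ≤ C) :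
    ‖F‖ ≤ C := by
  rw [← ZeroAtInftyContinuousMap.norm_toBCF_eq_norm]
  exact (BoundedContinuousFunction.norm_le hC).2 h

theorem norm_tensor_le {f : C_c(X, ℝ)} (hf : ∀ x, 0 ≤ f x ∧ f x ≤ 1) (A : E) :
    ‖tensor 𝕜 f A‖ ≤ ‖A‖ := by
  refine norm_zeroAtInfty_le (norm_nonneg _) fun x => ?_
  rw [tensor_apply, norm_smul, RCLike.norm_ofReal, abs_of_nonneg (hf x).1]
  exact mul_le_of_le_one_left (norm_nonneg _) (hf x).2

end Tensor

/-! ### Construction of the measure as a weak limit. -/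

section Construction

set_option maxSynthPendingDepth 3

variable {𝕜 X H K : Type*} [RCLike 𝕜] [TopologicalSpace X]
  [NormedAddCommGroup H] [InnerProductSpace 𝕜 H] [NormedAddCommGroup K] [InnerProductSpace 𝕜 K]
  {V₁ : Submodule 𝕜 (H →L[𝕜] H)} {V₂ : Submodule 𝕜 (K →L[𝕜] K)}
  {L : C₀(X, V₁) →L[𝕜] V₂}

/-- The operator `L(f ⊗ A)`. -/
noncomputable def tensorValue (L : C₀(X, V₁) →L[𝕜] V₂) (f : C_c(X, ℝ)) (A : V₁) : K →L[𝕜] K :=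
  (L (tensor 𝕜 f A) : K →L[𝕜] K)

theorem tensorValue_add_left (f g : C_c(X, ℝ)) (A : V₁) :
    tensorValue L (f + g) A = tensorValue L f A + tensorValue L g A := by
  simp only [tensorValue, tensor_add_left, map_add, Submodule.coe_add]

theorem tensorValue_sub_left (f g : C_c(X, ℝ)) (A : V₁) :
    tensorValue L (f - g) A = tensorValue L f A - tensorValue L g A := by
  simp only [tensorValue, tensor_sub_left, map_sub, Submodule.coe_sub]

theorem tensorValue_smul_left (c : ℝ) (f : C_c(X, ℝ)) (A : V₁) :
    tensorValue L (c • f) A = (c : 𝕜) • tensorValue L f A := by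
  simp only [tensorValue, tensor_smul_left, map_smul, Submodule.coe_smul]

theorem tensorValue_add_right (f : C_c(X, ℝ)) (A B : V₁) :
    tensorValue L f (A + B) = tensorValue L f A + tensorValue L f B := by
  simp only [tensorValue, tensor_add_right, map_add, Submodule.coe_add]

theorem tensorValue_sub_right (f : C_c(X, ℝ)) (A B : V₁) :
    tensorValue L f (A - B) = tensorValue L f A - tensorValue L f B := by
  simp only [tensorValue, tensor_sub_right, map_sub, Submodule.coe_sub]

theorem tensorValue_smul_right (f : C_c(X, ℝ)) (c : 𝕜) (A : V₁) :
    tensorValue L f (c • A) = c • tensorValue L f A := by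
  simp only [tensorValue, tensor_smul_right, map_smul, Submodule.coe_smul]

theorem norm_tensorValue_le (L : C₀(X, V₁) →L[𝕜] V₂) {f : C_c(X, ℝ)} (hf : ∀ x, 0 ≤ f x ∧ f x ≤ 1) (A : V₁) :
    ‖tensorValue L f A‖ ≤ ‖L‖ * ‖A‖ :=
  L.le_opNorm_of_le (norm_tensor_le hf A)

open scoped ComplexOrder in
theorem tensorValue_isPositive (hL : IsPositiveMap L) {f : C_c(X, ℝ)} (hf : ∀ x, 0 ≤ f x)
    {A : V₁} (hA : (A : H →L[𝕜] H).IsPositive) : (tensorValue L f A).IsPositive :=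
  hL _ fun x => hA.smul_of_nonneg (c := ((f x : ℝ) : 𝕜)) (RCLike.ofReal_nonneg.2 (hf x))

variable [CompleteSpace K]

theorem tensorValue_isSelfAdjoint (hL : IsPositiveMap L) (f : C_c(X, ℝ))
    {A : V₁} (hA : (A : H →L[𝕜] H).IsPositive) : IsSelfAdjoint (tensorValue L f A) := by
  have hf : f = f ⊔ 0 - (-f) ⊔ 0 := by
    ext x
    simp only [CompactlySupportedContinuousMap.coe_sub, Pi.sub_apply,
      CompactlySupportedContinuousMap.sup_apply, CompactlySupportedContinuousMap.coe_neg,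
      Pi.neg_apply, CompactlySupportedContinuousMap.coe_zero, Pi.zero_apply]
    rcases le_total (f x) 0 with h | h
    · rw [sup_eq_right.2 h, sup_eq_left.2 (by linarith)]; ring
    · rw [sup_eq_left.2 h, sup_eq_right.2 (by linarith)]; ring
  rw [hf, tensorValue_sub_left]
  refine (tensorValue_isPositive hL (fun x => ?_) hA).isSelfAdjoint.sub
    (tensorValue_isPositive hL (fun x => ?_) hA).isSelfAdjoint
  · exact le_sup_right
  · exact le_sup_right

/-- Polarization: the matrix elements of a hermitian operator in terms of its quadratic form. -/
theorem inner_eq_polarization {T : K →L[𝕜] K} (hT : IsSelfAdjoint T) (x y : K) :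
    inner 𝕜 y (T x) = (1 / 4 : 𝕜) *
      ((((RCLike.re (inner 𝕜 (x + y) (T (x + y))) : ℝ) : 𝕜)
          - (RCLike.re (inner 𝕜 (x - y) (T (x - y))) : ℝ))
        + (RCLike.I : 𝕜) * (((RCLike.re (inner 𝕜 (x + (RCLike.I : 𝕜) • y)
              (T (x + (RCLike.I : 𝕜) • y))) : ℝ) : 𝕜)
            - (RCLike.re (inner 𝕜 (x - (RCLike.I : 𝕜) • y)
              (T (x - (RCLike.I : 𝕜) • y))) : ℝ))) := by
  have hs := hT.isSymmetric
  have hre : ∀ z, ((RCLike.re (inner 𝕜 z (T z)) : ℝ) : 𝕜) = inner 𝕜 (T z) z := by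
    intro z
    rw [inner_re_symm]
    exact hs.coe_re_inner_apply_self z
  -- Conjugation moves `T x` to the second slot and flips the sign of `I`; the four diagonal values
  -- are real and stay fixed.
  have h := congrArg (starRingEnd 𝕜) (hs.inner_map_polarization x y)
  simp only [ContinuousLinearMap.coe_coe, inner_conj_symm] at h
  rw [h]
  simp only [hre]
  have hc : ∀ z, (starRingEnd 𝕜) (inner 𝕜 (T z) z) = inner 𝕜 (T z) z := fun z => by
    rw [inner_conj_symm]; exact (hs z z).symm
  rw [map_div₀, map_add, map_sub, map_sub, map_mul, map_mul, hc, hc, hc, hc, RCLike.conj_I,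
    map_ofNat]
  ring

variable [T2Space X] [LocallyCompactSpace X] [MeasurableSpace X] [BorelSpace X]

omit [CompleteSpace K] in
theorem exists_measure_tensorValue (hL : IsPositiveMap L) {A : V₁}
    (hA : (A : H →L[𝕜] H).IsPositive) (k : K) :
    ∃ μ : Measure X, IsFiniteMeasure μ ∧ IsCompactOpenRegular μ ∧
      ∀ f : C_c(X, ℝ), ∫ x, f x ∂μ = RCLike.re (inner 𝕜 k (tensorValue L f A k)) := by
  let Λ : C_c(X, ℝ) →ₗ[ℝ] ℝ :=
    { toFun := fun f => RCLike.re (inner 𝕜 k (tensorValue L f A k))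
      map_add' := fun f g => by
        rw [tensorValue_add_left, add_apply, inner_add_right, map_add]
      map_smul' := fun c f => by
        rw [tensorValue_smul_left, smul_apply, inner_smul_right, RCLike.re_ofReal_mul]
        rfl }
  refine exists_measure_of_positive Λ
    (fun f hf => (tensorValue_isPositive hL hf hA).re_inner_nonneg_right k)
    (‖k‖ * (‖L‖ * ‖A‖ * ‖k‖)) fun f hf => ?_
  refine (re_inner_le_norm _ _).trans ?_
  exact mul_le_mul_of_nonneg_left
    ((tensorValue L f A).le_of_opNorm_le (norm_tensorValue_le L hf A) k) (norm_nonneg _)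

/-- Polarization writes the matrix element as a combination of integrals of `f` against four Riesz
measures, and each integral converges to the measure of `Δ`. -/
theorem exists_tendsto_inner_of_isPositive (hL : IsPositiveMap L) {A : V₁}
    (hA : (A : H →L[𝕜] H).IsPositive) {Δ : Set X} (hΔ : MeasurableSet Δ) (x y : K) :
    ∃ z, Tendsto (fun f => inner 𝕜 y (tensorValue L f A x)) (approxFilter Δ) (𝓝 z) := by
  have key : ∀ k : K, ∃ z : 𝕜, Tendsto
      (fun f => ((RCLike.re (inner 𝕜 k (tensorValue L f A k)) : ℝ) : 𝕜))
      (approxFilter Δ) (𝓝 z) := by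
    intro k
    obtain ⟨μ, hμ, hr, hint⟩ := exists_measure_tensorValue hL hA k
    have h := tendsto_integral_approxFilter hΔ μ hr
    simp only [hint] at h
    exact ⟨_, (RCLike.continuous_ofReal.tendsto _).comp h⟩
  choose q hq using key
  exact ⟨_, Tendsto.congr
    (fun f => (inner_eq_polarization (tensorValue_isSelfAdjoint hL f hA) x y).symm)
    ((((hq _).sub (hq _)).add (((hq _).sub (hq _)).const_mul _)).const_mul _)⟩

variable [CompleteSpace H]

theorem exists_tendsto_inner (hV₁ : HasJordanParts V₁) (hL : IsPositiveMap L) (A : V₁)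
    {Δ : Set X} (hΔ : MeasurableSet Δ) (x y : K) :
    ∃ z, Tendsto (fun f => inner 𝕜 y (tensorValue L f A x)) (approxFilter Δ) (𝓝 z) := by
  obtain ⟨P, N, Q, R, hPN, hQR, hA⟩ := hV₁.exists_parts A
  obtain ⟨zP, hP⟩ := exists_tendsto_inner_of_isPositive hL hPN.pos hΔ x y
  obtain ⟨zN, hN⟩ := exists_tendsto_inner_of_isPositive hL hPN.neg hΔ x y
  obtain ⟨zQ, hQ⟩ := exists_tendsto_inner_of_isPositive hL hQR.pos hΔ x y
  obtain ⟨zR, hR⟩ := exists_tendsto_inner_of_isPositive hL hQR.neg hΔ x y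
  refine ⟨_, Tendsto.congr (fun f => ?_)
    (((hP.sub hN).add (hQ.const_mul RCLike.I)).sub (hR.const_mul RCLike.I))⟩
  rw [hA, tensorValue_sub_right, tensorValue_add_right, tensorValue_sub_right,
    tensorValue_smul_right, tensorValue_smul_right]
  simp only [sub_apply, add_apply, smul_apply, inner_sub_right, inner_add_right, inner_smul_right]

/-- `m(Δ)(A)` is the weak operator limit of `L(f ⊗ A)` as `f` approaches the indicator of `Δ`. -/
def IsLimitMeasure (L : C₀(X, V₁) →L[𝕜] V₂) (m : MeasSet X → (V₁ →L[𝕜] V₂)) : Prop :=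
  ∀ (Δ : MeasSet X) (A : V₁) (x y : K), Tendsto (fun f => inner 𝕜 y (tensorValue L f A x))
    (approxFilter (Δ : Set X)) (𝓝 (inner 𝕜 y (eval m A Δ x)))

/-- The limits at `A`, `B`, `A + B` and `c • A` are taken along the same filter, so linearity in `A`
is uniqueness of limits; the bound `‖L‖ ‖A‖` is that of `L(f ⊗ A)` for `0 ≤ f ≤ 1`. -/
theorem exists_isLimitMeasure (hV₁ : HasJordanParts V₁)
    (hV₂ : IsWeaklyClosed (V₂ : Set (K →L[𝕜] K))) (hL : IsPositiveMap L) :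
    ∃ m : MeasSet X → (V₁ →L[𝕜] V₂), IsLimitMeasure L m := by
  have key : ∀ (Δ : MeasSet X) (A : V₁), ∃ S : V₂, ‖S‖ ≤ ‖L‖ * ‖A‖ ∧
      ∀ x y, Tendsto (fun f => inner 𝕜 y (tensorValue L f A x))
        (approxFilter (Δ : Set X)) (𝓝 (inner 𝕜 y ((S : K →L[𝕜] K) x))) := by
    intro Δ A
    have := approxFilter_neBot Δ.2
    obtain ⟨S, hS, hlim⟩ := exists_weak_limit (T := fun f => tensorValue L f A)
      ((eventually_approxFilter (Δ : Set X)).mono fun f hf => norm_tensorValue_le L hf A)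
      fun x y => exists_tendsto_inner hV₁ hL A Δ.2 x y
    refine ⟨⟨S, hV₂ (map (fun f => tensorValue L f A) (approxFilter (Δ : Set X))) S ?_ ?_⟩,
      hS, hlim⟩
    · exact eventually_map.2 (Eventually.of_forall fun f => (L (tensor 𝕜 f A)).2)
    · exact fun x y => tendsto_map'_iff.2 (hlim x y)
  choose S hS hlim using key
  have huniq : ∀ (Δ : MeasSet X) (T T' : V₂),
      (∀ x y, ∃ g : C_c(X, ℝ) → 𝕜,
        Tendsto g (approxFilter (Δ : Set X)) (𝓝 (inner 𝕜 y ((T : K →L[𝕜] K) x))) ∧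
        Tendsto g (approxFilter (Δ : Set X)) (𝓝 (inner 𝕜 y ((T' : K →L[𝕜] K) x)))) → T = T' := by
    intro Δ T T' h
    have := approxFilter_neBot Δ.2
    refine Subtype.ext (ContinuousLinearMap.ext fun x => ext_inner_left 𝕜 fun y => ?_)
    obtain ⟨g, h1, h2⟩ := h x y
    exact tendsto_nhds_unique h1 h2
  refine ⟨fun Δ => LinearMap.mkContinuous
    { toFun := S Δ
      map_add' := fun A B => huniq Δ _ _ fun x y => ⟨_, hlim Δ (A + B) x y, ?_⟩
      map_smul' := fun c A => huniq Δ _ _ fun x y => ⟨_, hlim Δ (c • A) x y, ?_⟩ } ‖L‖ (hS Δ),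
    hlim⟩
  · simpa only [tensorValue_add_right, add_apply, inner_add_right, Submodule.coe_add] using
      (hlim Δ A x y).add (hlim Δ B x y)
  · simpa only [tensorValue_smul_right, smul_apply, inner_smul_right, Submodule.coe_smul,
      RingHom.id_apply] using (hlim Δ A x y).const_mul c

end Construction

/-! ### Positive operator-valued measures and their quadratic measures. -/

section POVM

variable {𝕜 X K : Type*} [RCLike 𝕜] [MeasurableSpace X]
  [NormedAddCommGroup K] [InnerProductSpace 𝕜 K]

/-- Weak countable additivity of a positive operator-valued set function implies strong countable
additivity. -/
theorem isPOVM_of_measure {E : MeasSet X → (K →L[𝕜] K)} (hpos : ∀ Δ, (E Δ).IsPositive)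
    (hform : ∀ k, ∃ μ : Measure X, IsFiniteMeasure μ ∧
      ∀ Δ : MeasSet X, RCLike.re (inner 𝕜 k (E Δ k)) = μ.real Δ) : IsPOVM E := by
  refine ⟨hpos, fun Δ hΔ k => ?_⟩
  set U : MeasSet X := ⟨⋃ n, (Δ n : Set X), MeasurableSet.iUnion fun n => (Δ n).2⟩ with hU
  -- The remainder is a positive operator with form at most `‖E U‖ ‖y‖²`, so `‖R s k‖² ≤ ‖E U‖ ⟨R s
  -- k, k⟩`, which tends to zero by countable additivity of the form.
  let R : Finset ℕ → (K →L[𝕜] K) := fun s => E U - ∑ n ∈ s, E (Δ n)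
  have hR : ∀ s k, RCLike.re (inner 𝕜 k (R s k))
      = RCLike.re (inner 𝕜 k (E U k)) - ∑ n ∈ s, RCLike.re (inner 𝕜 k (E (Δ n) k)) := by
    intro s k
    simp only [R, sub_apply, sum_apply, inner_sub_right, inner_sum, map_sub, map_sum]
  have hle : ∀ s k, ∑ n ∈ s, RCLike.re (inner 𝕜 k (E (Δ n) k))
      ≤ RCLike.re (inner 𝕜 k (E U k)) := by
    intro s k
    obtain ⟨μ, hμ, h⟩ := hform k
    simp only [h]
    rw [← measureReal_biUnion_finset (fun i _ j _ hij => hΔ hij) fun n _ => (Δ n).2]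
    exact measureReal_mono (Set.iUnion₂_subset fun n _ => Set.subset_iUnion
      (fun n => (Δ n : Set X)) n)
  have hRpos : ∀ s, (R s).IsPositive := by
    intro s
    rw [ContinuousLinearMap.isPositive_def]
    refine ⟨?_, fun k => ?_⟩
    · intro x y
      have h1 := (ContinuousLinearMap.isPositive_sum s fun n _ => hpos (Δ n)).isSymmetric x y
      have h2 := (hpos U).isSymmetric x y
      change inner 𝕜 (E U x - (∑ n ∈ s, E (Δ n)) x) y = inner 𝕜 x (E U y - (∑ n ∈ s, E (Δ n)) y)
      rw [inner_sub_left, inner_sub_right]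
      exact congrArg₂ _ h2 h1
    · rw [ContinuousLinearMap.reApplyInnerSelf_apply, inner_re_symm, hR]
      exact sub_nonneg.2 (hle s k)
  have hM : ∀ s y, RCLike.re (inner 𝕜 y (R s y)) ≤ ‖E U‖ * ‖y‖ ^ 2 := by
    intro s y
    rw [hR]
    have h1 : 0 ≤ ∑ n ∈ s, RCLike.re (inner 𝕜 y (E (Δ n) y)) :=
      Finset.sum_nonneg fun n _ => (hpos (Δ n)).re_inner_nonneg_right y
    have h2 := (re_inner_le_norm (𝕜 := 𝕜) y (E U y)).trans
      (mul_le_mul_of_nonneg_left ((E U).le_opNorm y) (norm_nonneg y))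
    nlinarith
  have hlim : Tendsto (fun s => RCLike.re (inner 𝕜 k (R s k))) atTop (𝓝 0) := by
    obtain ⟨μ, hμ, h⟩ := hform k
    simp only [hR, h]
    have h1 : HasSum (fun n => μ.real (Δ n)) (μ.real U) :=
      by
      have h0 := measure_iUnion hΔ (fun n => (Δ n).2) (μ := μ)
      have h1 := ENNReal.hasSum_toReal (f := fun n => μ (Δ n)) (h0 ▸ measure_ne_top μ _)
      rwa [← ENNReal.tsum_toReal_eq fun n => measure_ne_top μ _, ← h0] at h1
    have h2 : Tendsto (fun s => μ.real U - ∑ n ∈ s, μ.real (Δ n)) atTop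
      (𝓝 (μ.real U - μ.real U)) := tendsto_const_nhds.sub h1
    rwa [sub_self] at h2
  have hnorm : Tendsto (fun s => ‖R s k‖ ^ 2) atTop (𝓝 0) := by
    refine squeeze_zero (fun s => sq_nonneg _)
      (fun s => norm_apply_sq_le_of_isPositive (hRpos s) (hM s) k) ?_
    simpa using hlim.const_mul ‖E U‖
  have hnorm2 : Tendsto (fun s => ‖R s k‖) atTop (𝓝 0) := by
    have := (Real.continuous_sqrt.tendsto 0).comp hnorm
    simpa [Function.comp_def, Real.sqrt_sq (norm_nonneg _)] using this
  have h3 := tendsto_const_nhds (x := E U k) (f := atTop (α := Finset ℕ)) |>.sub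
    (tendsto_zero_iff_norm_tendsto_zero.2 hnorm2)
  rw [sub_zero] at h3
  refine h3.congr fun s => ?_
  simp [R]

namespace IsPOVM

variable {E : MeasSet X → (K →L[𝕜] K)} (hE : IsPOVM E)

include hE

theorem quadMeasure_real (k : K) (Δ : MeasSet X) :
    (hE.quadMeasure k).real Δ = RCLike.re (inner 𝕜 k (E Δ k)) := by
  rw [measureReal_def, hE.quadMeasure_apply, ENNReal.toReal_ofReal (hE.inner_nonneg Δ k)]

theorem isFiniteMeasure_quadMeasure (k : K) : IsFiniteMeasure (hE.quadMeasure k) := by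
  refine ⟨?_⟩
  have := hE.quadMeasure_apply k ⟨Set.univ, MeasurableSet.univ⟩
  rw [this]
  exact ENNReal.ofReal_lt_top

theorem quadMeasure_eq {k : K} {μ : Measure X} [IsFiniteMeasure μ]
    (h : ∀ Δ : MeasSet X, RCLike.re (inner 𝕜 k (E Δ k)) = μ.real Δ) : hE.quadMeasure k = μ := by
  ext s hs
  have := hE.quadMeasure_apply k ⟨s, hs⟩
  rw [this, h]
  exact ofReal_measureReal

theorem quadMeasure_smul (c : 𝕜) (k : K) :
    hE.quadMeasure (c • k) = ENNReal.ofReal (‖c‖ ^ 2) • hE.quadMeasure k := by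
  ext s hs
  have h1 := hE.quadMeasure_apply (c • k) ⟨s, hs⟩
  have h2 := hE.quadMeasure_apply k ⟨s, hs⟩
  rw [Measure.smul_apply, h1, h2, smul_eq_mul, ← ENNReal.ofReal_mul (sq_nonneg _)]
  congr 1
  rw [map_smul, inner_smul_left, inner_smul_right, ← mul_assoc, RCLike.conj_mul,
    ← RCLike.ofReal_pow, RCLike.re_ofReal_mul]

theorem integrable_of_bound {f : X → 𝕜} (hf : Measurable f) {C : ℝ} (hC : ∀ x, ‖f x‖ ≤ C) :
    hE.Integrable f := by
  -- On an empty space the bound `C` may be negative.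
  rcases isEmpty_or_nonempty X with hX | ⟨⟨x₀⟩⟩
  · refine ⟨hf, 0, fun k => ?_⟩
    rw [Measure.eq_zero_of_isEmpty (hE.quadMeasure k)]
    simp
  have hC0 : 0 ≤ C := (norm_nonneg _).trans (hC x₀)
  refine ⟨hf, C * ‖E ⟨Set.univ, MeasurableSet.univ⟩‖, fun k => ?_⟩
  have h1 := hE.quadMeasure_apply k ⟨Set.univ, MeasurableSet.univ⟩
  calc ∫⁻ x, ENNReal.ofReal ‖f x‖ ∂(hE.quadMeasure k)
      ≤ ∫⁻ _, ENNReal.ofReal C ∂(hE.quadMeasure k) :=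
        lintegral_mono fun x => ENNReal.ofReal_le_ofReal (hC x)
    _ = ENNReal.ofReal (C * RCLike.re (inner 𝕜 k (E ⟨Set.univ, MeasurableSet.univ⟩ k))) := by
        rw [lintegral_const, ENNReal.ofReal_mul hC0]
        exact congrArg _ h1
    _ ≤ _ := by
        refine ENNReal.ofReal_le_ofReal ?_
        rw [mul_assoc]
        refine mul_le_mul_of_nonneg_left ?_ hC0
        refine (re_inner_le_norm _ _).trans ?_
        have := mul_le_mul_of_nonneg_left
          ((E ⟨Set.univ, MeasurableSet.univ⟩).le_opNorm k) (norm_nonneg k)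
        nlinarith

theorem integrable_quadMeasure {f : X → 𝕜} (hf : hE.Integrable f) (k : K) :
    MeasureTheory.Integrable f (hE.quadMeasure k) := by
  obtain ⟨hm, C, hC⟩ := hf
  refine ⟨hm.aestronglyMeasurable, ?_⟩
  rw [hasFiniteIntegral_iff_norm]
  exact (hC k).trans_lt ENNReal.ofReal_lt_top

/-- On the diagonal all four measures in the polarization are multiples `|c|² E_k`, with `c = 2, 0,
1 + i, 1 - i`; the last two cancel and the first contributes `4 / 4`. -/
theorem inner_self_of_hasIntegral {f : X → 𝕜} {T : K →L[𝕜] K} (h : hE.HasIntegral f T) (k : K) :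
    inner 𝕜 k (T k) = ∫ x, f x ∂(hE.quadMeasure k) := by
  rw [h.2 k k]
  have e1 : k + k = (2 : 𝕜) • k := (two_smul 𝕜 k).symm
  have e2 : k - k = (0 : 𝕜) • k := by simp
  have e3 : k + (RCLike.I : 𝕜) • k = (1 + RCLike.I : 𝕜) • k := by rw [add_smul, one_smul]
  have e4 : k - (RCLike.I : 𝕜) • k = (1 - RCLike.I : 𝕜) • k := by rw [sub_smul, one_smul]
  have e5 : ‖(1 - RCLike.I : 𝕜)‖ = ‖(1 + RCLike.I : 𝕜)‖ := by
    rw [← RCLike.norm_conj (1 + RCLike.I : 𝕜)]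
    simp [sub_eq_add_neg]
  rw [e1, e2, e3, e4, quadMeasure_smul, quadMeasure_smul, quadMeasure_smul, quadMeasure_smul, e5]
  simp only [integral_smul_measure, sub_self, mul_zero, add_zero, norm_zero]
  rw [ENNReal.toReal_ofReal (by positivity), ENNReal.toReal_ofReal (by positivity)]
  simp only [RCLike.norm_ofNat, ne_eq, OfNat.ofNat_ne_zero, not_false_eq_true, zero_pow, zero_smul,
    sub_zero]
  rw [RCLike.real_smul_eq_coe_mul, ← mul_assoc]
  push_cast
  norm_num

/-- Cauchy–Schwarz bounds `|⟨E(Γ)k₁, k₂⟩|` by `E_{k₁}(Γ) + E_{k₂}(Γ)`, so sets chosen for the sum of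
the two measures suffice. -/
theorem isRegularSetFunction [TopologicalSpace X] [T2Space X] [BorelSpace X]
    (h : ∀ k, IsCompactOpenRegular (hE.quadMeasure k)) (k₁ k₂ : K) :
    IsRegularSetFunction (fun Δ => inner 𝕜 k₂ (E Δ k₁)) := by
  intro Δ ε hε
  have := hE.isFiniteMeasure_quadMeasure
  obtain ⟨C, U, hC, hU, hCΔ, hΔU, hlt⟩ := ((h k₁).add (h k₂)) Δ Δ.2 ε hε
  refine ⟨C, U, hC, hU, hCΔ, hΔU, fun Γ hΓ => ?_⟩
  have h1 := norm_inner_sq_le_of_isPositive (hE.isPositive Γ) k₁ k₂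
  have h2 : ((hE.quadMeasure k₁ + hE.quadMeasure k₂)).real Γ < ε :=
    (measureReal_mono hΓ).trans_lt hlt
  rw [measureReal_add_apply, hE.quadMeasure_real, hE.quadMeasure_real] at h2
  have h3 := hE.inner_nonneg Γ k₁
  have h4 := hE.inner_nonneg Γ k₂
  refine lt_of_le_of_lt ?_ h2
  refine le_of_sq_le_sq (h1.trans ?_) (add_nonneg h3 h4)
  nlinarith

theorem isCompactOpenRegular_quadMeasure [TopologicalSpace X] [T2Space X] [BorelSpace X]
    {k : K} (h : IsRegularSetFunction (fun Δ => inner 𝕜 k (E Δ k))) :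
    IsCompactOpenRegular (hE.quadMeasure k) := by
  intro Δ hΔ ε hε
  obtain ⟨C, U, hC, hU, hCΔ, hΔU, hlt⟩ := h ⟨Δ, hΔ⟩ ε hε
  refine ⟨C, U, hC, hU, hCΔ, hΔU, ?_⟩
  have := hE.quadMeasure_real k ⟨U \ C, hU.measurableSet.diff hC.measurableSet⟩
  rw [this]
  exact (RCLike.re_le_norm _).trans_lt (hlt _ subset_rfl)

end IsPOVM

end POVM

/-! ### Density of sums of elementary tensors. -/

section Density

theorem zeroAtInfty_sum_apply {X E ι : Type*} [TopologicalSpace X] [NormedAddCommGroup E]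
    (s : Finset ι) (F : ι → C₀(X, E)) (x : X) : (∑ i ∈ s, F i) x = ∑ i ∈ s, F i x :=
  map_sum (⟨⟨fun G : C₀(X, E) => G x, rfl⟩, fun _ _ => rfl⟩ : C₀(X, E) →+ E) F s

variable {𝕜 X E : Type*} [RCLike 𝕜] [TopologicalSpace X] [T2Space X] [LocallyCompactSpace X]
  [NormedAddCommGroup E] [NormedSpace 𝕜 E]

/-- Finite sums of elementary tensors are dense in `C₀(X, E)`. -/
theorem exists_sum_tensor_norm_sub_le (F : C₀(X, E)) {ε : ℝ} (hε : 0 < ε) :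
    ∃ (n : ℕ) (f : Fin n → C_c(X, ℝ)) (A : Fin n → E),
      ‖F - ∑ i, tensor 𝕜 (f i) (A i)‖ ≤ ε := by
  have hcomp : ∃ S : Set X, IsCompact S ∧ ∀ x ∉ S, ‖F x‖ < ε := by
    have h : ∀ᶠ x in cocompact X, ‖F x‖ < ε := by
      have := (zero_at_infty F).norm
      rw [norm_zero] at this
      exact this.eventually_lt_const hε
    obtain ⟨S, hS, hSF⟩ := mem_cocompact.1 h
    exact ⟨S, hS, fun x hx => hSF hx⟩
  obtain ⟨S, hS, hSF⟩ := hcomp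
  let U : X → Set X := fun y => {x | ‖F x - F y‖ < ε}
  have hU : ∀ y, IsOpen (U y) := fun y =>
    isOpen_lt ((map_continuous F).sub continuous_const).norm continuous_const
  obtain ⟨t, ht⟩ := hS.elim_finite_subcover U hU fun x _ =>
    Set.mem_iUnion.2 ⟨x, by simpa [U] using hε⟩
  let e := t.equivFin
  let y : Fin t.card → X := fun i => (e.symm i : X)
  have hcov : S ⊆ ⋃ i, U (y i) := by
    intro x hx
    obtain ⟨z, hz, hxz⟩ := Set.mem_iUnion₂.1 (ht hx)
    exact Set.mem_iUnion.2 ⟨e ⟨z, hz⟩, by simpa [y] using hxz⟩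
  obtain ⟨p, hp, hpc⟩ := PartitionOfUnity.exists_isSubordinate_of_locallyFinite_t2space hS
    (fun i => U (y i)) (fun i => hU _) (locallyFinite_of_finite _) hcov
  refine ⟨t.card, fun i => ⟨p i, hpc i⟩, fun i => F (y i), ?_⟩
  refine norm_zeroAtInfty_le hε.le fun x => ?_
  have hsum : ∑ i, p i x ≤ 1 := by
    rw [← finsum_eq_sum_of_fintype]; exact p.sum_le_one x
  -- The first term vanishes on `S`, and off `S` the values of `F` are below `ε`; in the second, `F`
  -- is within `ε` of `F (y i)` on the support of `p i`. The weights add up to 1.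
  have hval : (F - ∑ i, tensor 𝕜 (⟨p i, hpc i⟩ : C_c(X, ℝ)) (F (y i))) x
      = ((1 - ∑ i, p i x : ℝ) : 𝕜) • F x + ∑ i, ((p i x : ℝ) : 𝕜) • (F x - F (y i)) := by
    have h1 : (∑ i, tensor 𝕜 (⟨p i, hpc i⟩ : C_c(X, ℝ)) (F (y i))) x
        = ∑ i, ((p i x : ℝ) : 𝕜) • F (y i) := by
      rw [zeroAtInfty_sum_apply]
      rfl
    rw [ZeroAtInftyContinuousMap.coe_sub, Pi.sub_apply, h1]
    simp only [smul_sub, Finset.sum_sub_distrib, ← Finset.sum_smul]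
    push_cast
    rw [sub_smul, one_smul]
    abel
  rw [hval]
  have h1 : ‖((1 - ∑ i, p i x : ℝ) : 𝕜) • F x‖ ≤ (1 - ∑ i, p i x) * ε := by
    rw [norm_smul, RCLike.norm_ofReal, abs_of_nonneg (sub_nonneg.2 hsum)]
    by_cases hx : x ∈ S
    · have : ∑ i, p i x = 1 := by
        rw [← finsum_eq_sum_of_fintype]; exact p.sum_eq_one hx
      rw [this]; simp
    · exact mul_le_mul_of_nonneg_left (hSF x hx).le (sub_nonneg.2 hsum)
  have h2 : ‖∑ i, ((p i x : ℝ) : 𝕜) • (F x - F (y i))‖ ≤ (∑ i, p i x) * ε := by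
    rw [Finset.sum_mul]
    refine norm_sum_le_of_le _ fun i _ => ?_
    rw [norm_smul, RCLike.norm_ofReal, abs_of_nonneg (p.nonneg i x)]
    by_cases hx : x ∈ tsupport (p i)
    · exact mul_le_mul_of_nonneg_left (hp i hx).le (p.nonneg i x)
    · rw [image_eq_zero_of_notMem_tsupport hx]; simp
  linarith [norm_add_le (((1 - ∑ i, p i x : ℝ) : 𝕜) • F x)
    (∑ i, ((p i x : ℝ) : 𝕜) • (F x - F (y i)))]

end Density

/-! ### The weak limit is a regular non-negative measure representing `L`. -/

section Existence

set_option maxSynthPendingDepth 3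

variable {𝕜 X H K : Type*} [RCLike 𝕜] [TopologicalSpace X]
  [NormedAddCommGroup H] [InnerProductSpace 𝕜 H] [NormedAddCommGroup K] [InnerProductSpace 𝕜 K]
  {V₁ : Submodule 𝕜 (H →L[𝕜] H)} {V₂ : Submodule 𝕜 (K →L[𝕜] K)}
  {L : C₀(X, V₁) →L[𝕜] V₂}
  [T2Space X] [LocallyCompactSpace X] [MeasurableSpace X] [BorelSpace X]
  {m : MeasSet X → (V₁ →L[𝕜] V₂)}

theorem IsLimitMeasure.re_inner_eq (hm : IsLimitMeasure L m) {A : V₁} {k : K} {μ : Measure X}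
    [IsFiniteMeasure μ] (hμ : IsCompactOpenRegular μ)
    (h : ∀ f : C_c(X, ℝ), ∫ x, f x ∂μ = RCLike.re (inner 𝕜 k (tensorValue L f A k)))
    (Δ : MeasSet X) : RCLike.re (inner 𝕜 k (eval m A Δ k)) = μ.real Δ := by
  have := approxFilter_neBot Δ.2
  have h1 := tendsto_integral_approxFilter Δ.2 μ hμ
  simp only [h] at h1
  exact tendsto_nhds_unique ((RCLike.continuous_re.tendsto _).comp (hm Δ A k k)) h1

/-- The quadratic measure is the Riesz measure itself; regularity and the integrals of `C_c`
functions are read off from this. -/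
theorem IsLimitMeasure.quadMeasure_spec (hm : IsLimitMeasure L m) (hL : IsPositiveMap L) {A : V₁}
    (hA : (A : H →L[𝕜] H).IsPositive) (hE : IsPOVM (eval m A)) (k : K) :
    IsCompactOpenRegular (hE.quadMeasure k) ∧
      ∀ f : C_c(X, ℝ), ∫ x, f x ∂(hE.quadMeasure k)
        = RCLike.re (inner 𝕜 k (tensorValue L f A k)) := by
  obtain ⟨μ, hμ, hr, h⟩ := exists_measure_tensorValue hL hA k
  rw [hE.quadMeasure_eq (hm.re_inner_eq hr h)]
  exact ⟨hr, h⟩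

omit [T2Space X] [LocallyCompactSpace X] in
theorem integrable_compactlySupported_ofReal (hm : IsNonnegMeasure m) (f : C_c(X, ℝ)) :
    hm.Integrable fun x => ((f x : ℝ) : 𝕜) := by
  obtain ⟨C, hC⟩ := f.hasCompactSupport.exists_bound_of_continuous f.continuous
  exact fun A hA => (hm A hA).integrable_of_bound
    (RCLike.continuous_ofReal.comp f.continuous).measurable (C := C)
    fun x => by rw [RCLike.norm_ofReal]; exact hC x

variable [CompleteSpace K]

theorem IsLimitMeasure.isPositive (hm : IsLimitMeasure L m) (hL : IsPositiveMap L) {A : V₁}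
    (hA : (A : H →L[𝕜] H).IsPositive) (Δ : MeasSet X) : (eval m A Δ).IsPositive := by
  have := approxFilter_neBot Δ.2
  refine isWeaklyClosed_isPositive (map (fun f => tensorValue L f A) (approxFilter (Δ : Set X))) _
    ?_ fun x y => tendsto_map'_iff.2 (hm Δ A x y)
  exact eventually_map.2 ((eventually_approxFilter (Δ : Set X)).mono fun f hf =>
    tensorValue_isPositive hL (fun x => (hf x).1) hA)

theorem IsLimitMeasure.isNonnegMeasure (hm : IsLimitMeasure L m) (hL : IsPositiveMap L) :
    IsNonnegMeasure m := fun A hA =>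
  isPOVM_of_measure (hm.isPositive hL hA) fun k => by
    obtain ⟨μ, hμ, hr, h⟩ := exists_measure_tensorValue hL hA k
    exact ⟨μ, hμ, hm.re_inner_eq hr h⟩

theorem IsLimitMeasure.isRegular (hm : IsLimitMeasure L m) (hL : IsPositiveMap L) :
    IsRegular m := fun A hA =>
  (hm.isNonnegMeasure hL A hA).isRegularSetFunction fun k =>
    (hm.quadMeasure_spec hL hA _ k).1

theorem IsLimitMeasure.hasIntegral_of_isPositive (hm : IsLimitMeasure L m) (hL : IsPositiveMap L)
    (hmn : IsNonnegMeasure m) {A : V₁} (hA : (A : H →L[𝕜] H).IsPositive) (f : C_c(X, ℝ)) :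
    (hmn A hA).HasIntegral (fun x => ((f x : ℝ) : 𝕜)) (tensorValue L f A) := by
  refine ⟨integrable_compactlySupported_ofReal hmn f A hA, fun k₁ k₂ => ?_⟩
  rw [inner_eq_polarization (tensorValue_isSelfAdjoint hL f hA) k₁ k₂]
  simp only [integral_ofReal, (hm.quadMeasure_spec hL hA (hmn A hA) _).2 f]

variable [CompleteSpace H]

theorem IsLimitMeasure.hasIntegralOn (hm : IsLimitMeasure L m) (hL : IsPositiveMap L)
    (hV₁ : HasJordanParts V₁) (hmn : IsNonnegMeasure m) (A : V₁) (f : C_c(X, ℝ)) :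
    hmn.HasIntegralOn (fun x => ((f x : ℝ) : 𝕜)) A (tensorValue L f A) := by
  obtain ⟨P, N, Q, R, hPN, hQR, hA⟩ := hV₁.exists_parts A
  refine ⟨integrable_compactlySupported_ofReal hmn f, P, N, Q, R, hPN, hQR, _, _, _, _,
    hm.hasIntegral_of_isPositive hL hmn hPN.pos f, hm.hasIntegral_of_isPositive hL hmn hPN.neg f,
    hm.hasIntegral_of_isPositive hL hmn hQR.pos f, hm.hasIntegral_of_isPositive hL hmn hQR.neg f,
    ?_⟩
  conv_lhs => rw [hA]
  rw [tensorValue_sub_right, tensorValue_add_right, tensorValue_sub_right, tensorValue_smul_right,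
    tensorValue_smul_right]

theorem IsLimitMeasure.isRepresentingMeasure (hm : IsLimitMeasure L m) (hL : IsPositiveMap L)
    (hV₁ : HasJordanParts V₁) : IsRepresentingMeasure L m := by
  refine ⟨hm.isRegular hL, hm.isNonnegMeasure hL, fun F => ?_⟩
  have hpos : ∀ i : ℕ, 0 < 1 / ((i : ℝ) + 1) := fun i => Nat.one_div_pos_of_nat
  choose n f A hfA using fun i : ℕ => exists_sum_tensor_norm_sub_le (𝕜 := 𝕜) F (hpos i)
  have hlim : Tendsto (fun i => ∑ j, tensor 𝕜 (f i j) (A i j)) atTop (𝓝 F) := by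
    rw [tendsto_iff_norm_sub_tendsto_zero]
    refine squeeze_zero (fun _ => norm_nonneg _) (fun i => ?_) tendsto_one_div_add_atTop_nhds_zero_nat
    rw [norm_sub_rev]
    exact hfA i
  refine ⟨fun i => ⇑(∑ j, tensor 𝕜 (f i j) (A i j)),
    fun i => (L (∑ j, tensor 𝕜 (f i j) (A i j)) : K →L[𝕜] K), fun i => ?_, ?_, ?_⟩
  · refine ⟨n i, fun j x => ((f i j x : ℝ) : 𝕜), A i, fun j => tensorValue L (f i j) (A i j),
      fun x => ?_, fun j => hm.hasIntegralOn hL hV₁ _ _ _, ?_⟩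
    · exact zeroAtInfty_sum_apply _ _ x
    · dsimp only
      rw [map_sum, Submodule.coe_sum]
      rfl
  · exact ZeroAtInftyContinuousMap.tendsto_iff_tendstoUniformly.1 hlim
  · exact ((continuous_subtype_val.comp L.continuous).tendsto F).comp hlim

end Existence

/-! ### Bounding the integral by the supremum norm. -/

section Uniqueness

set_option maxSynthPendingDepth 3

theorem inner_self_eq_re_of_isPositive {𝕜 K : Type*} [RCLike 𝕜] [NormedAddCommGroup K]
    [InnerProductSpace 𝕜 K] {T : K →L[𝕜] K} (hT : T.IsPositive) (k : K) :
    inner 𝕜 k (T k) = ((RCLike.re (inner 𝕜 k (T k)) : ℝ) : 𝕜) := by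
  rw [← hT.inner_left_eq_inner_right k k]
  exact (hT.isSymmetric.coe_re_inner_apply_self k).symm

variable {𝕜 X H K : Type*} [RCLike 𝕜] [NormedAddCommGroup H] [InnerProductSpace 𝕜 H]
  [NormedAddCommGroup K] [InnerProductSpace 𝕜 K]
  {V₁ : Submodule 𝕜 (H →L[𝕜] H)} {V₂ : Submodule 𝕜 (K →L[𝕜] K)}
  [MeasurableSpace X] {m : MeasSet X → (V₁ →L[𝕜] V₂)}

theorem eval_sub (m : MeasSet X → (V₁ →L[𝕜] V₂)) (A B : V₁) (Δ : MeasSet X) :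
    eval m (A - B) Δ = eval m A Δ - eval m B Δ := by
  simp only [eval, map_sub, Submodule.coe_sub]

theorem eval_add (m : MeasSet X → (V₁ →L[𝕜] V₂)) (A B : V₁) (Δ : MeasSet X) :
    eval m (A + B) Δ = eval m A Δ + eval m B Δ := by
  simp only [eval, map_add, Submodule.coe_add]

theorem eval_smul (m : MeasSet X → (V₁ →L[𝕜] V₂)) (c : 𝕜) (A : V₁) (Δ : MeasSet X) :
    eval m (c • A) Δ = c • eval m A Δ := by
  simp only [eval, map_smul, Submodule.coe_smul]

theorem eval_sum {ι : Type*} (m : MeasSet X → (V₁ →L[𝕜] V₂)) (s : Finset ι) (A : ι → V₁)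
    (Δ : MeasSet X) : eval m (∑ i ∈ s, A i) Δ = ∑ i ∈ s, eval m (A i) Δ := by
  simp only [eval, map_sum, Submodule.coe_sum]

variable [CompleteSpace H]

theorem isPositive_smul_one_sub {T : H →L[𝕜] H} (hT : IsSelfAdjoint T) {c : ℝ} (hc : ‖T‖ ≤ c) :
    ((c : 𝕜) • (1 : H →L[𝕜] H) - T).IsPositive := by
  rw [ContinuousLinearMap.isPositive_def']
  refine ⟨(isSelfAdjoint_algebraMap_smul (IsSelfAdjoint.one _) c).sub hT, fun x => ?_⟩
  rw [ContinuousLinearMap.reApplyInnerSelf_apply, inner_re_symm, sub_apply, smul_apply,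
    inner_sub_right, inner_smul_right, map_sub, RCLike.re_ofReal_mul, sub_nonneg]
  refine (re_inner_le_norm _ _).trans ?_
  have h1 : RCLike.re (inner 𝕜 x ((1 : H →L[𝕜] H) x)) = ‖x‖ ^ 2 :=
    (norm_sq_eq_re_inner (𝕜 := 𝕜) x).symm
  have h2 := mul_le_mul_of_nonneg_left (T.le_of_opNorm_le hc x) (norm_nonneg x)
  rw [h1]
  nlinarith

/-- The identity as an element of a space of operators. -/
def HasJordanParts.one (hV₁ : HasJordanParts V₁) : V₁ := ⟨1, hV₁.one_mem⟩

theorem HasJordanParts.isPositive_one (hV₁ : HasJordanParts V₁) :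
    (hV₁.one : H →L[𝕜] H).IsPositive := ContinuousLinearMap.isPositive_one

/-- From `-c ≤ A ≤ c`, since `m(Δ)` preserves order. -/
theorem IsNonnegMeasure.norm_inner_le_of_isJordanParts (hm : IsNonnegMeasure m)
    (hV₁ : HasJordanParts V₁) {A : H →L[𝕜] H} {P N : V₁} (h : IsJordanParts A P N) {c : ℝ}
    (hc : ‖A‖ ≤ c) (Δ : MeasSet X) (k : K) :
    ‖inner 𝕜 k (eval m (P - N) Δ k)‖ ≤ c * RCLike.re (inner 𝕜 k (eval m hV₁.one Δ k)) := by
  have hA : IsSelfAdjoint A := by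
    rw [h.sub_eq]; exact h.pos.isSelfAdjoint.sub h.neg.isSelfAdjoint
  have h1 : (((c : 𝕜) • hV₁.one - (P - N) : V₁) : H →L[𝕜] H).IsPositive := by
    have := isPositive_smul_one_sub hA hc
    rwa [h.sub_eq] at this
  have h2 : (((c : 𝕜) • hV₁.one - (N - P) : V₁) : H →L[𝕜] H).IsPositive := by
    have := isPositive_smul_one_sub hA.neg (c := c) (by rwa [norm_neg])
    rwa [h.sub_eq, neg_sub] at this
  have e1 := (hm _ h1).inner_nonneg Δ k
  have e2 := (hm _ h2).inner_nonneg Δ k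
  simp only [eval_sub, eval_smul, sub_apply, smul_apply, inner_sub_right, inner_smul_right,
    map_sub, RCLike.re_ofReal_mul] at e1 e2
  rw [eval_sub, sub_apply, inner_sub_right,
    inner_self_eq_re_of_isPositive ((hm P h.pos).isPositive Δ) k,
    inner_self_eq_re_of_isPositive ((hm N h.neg).isPositive Δ) k, ← RCLike.ofReal_sub,
    RCLike.norm_ofReal, abs_le]
  constructor <;> linarith

/-- The factor 2 comes from adding the bounds for the real and the imaginary part. -/
theorem IsNonnegMeasure.norm_inner_le (hm : IsNonnegMeasure m) (hV₁ : HasJordanParts V₁)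
    (A : V₁) (Δ : MeasSet X) (k : K) :
    ‖inner 𝕜 k (eval m A Δ k)‖ ≤ 2 * ‖A‖ * RCLike.re (inner 𝕜 k (eval m hV₁.one Δ k)) := by
  obtain ⟨P, N, Q, R, hPN, hQR, hA⟩ := hV₁.exists_parts A
  have hre : ‖(1 / 2 : 𝕜) • ((A : H →L[𝕜] H) + star (A : H →L[𝕜] H))‖ ≤ ‖A‖ := by
    rw [norm_smul]
    have := norm_add_le (A : H →L[𝕜] H) (star (A : H →L[𝕜] H))
    rw [norm_star] at this
    have h2 : ‖(1 / 2 : 𝕜)‖ = 1 / 2 := by simp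
    rw [h2]
    change _ ≤ ‖(A : H →L[𝕜] H)‖
    linarith
  have hI : ‖(RCLike.I : 𝕜)‖ ≤ 1 := by
    rcases eq_or_ne (RCLike.I : 𝕜) 0 with h | h
    · simp [h]
    · rw [RCLike.norm_I_of_ne_zero h]
  have him : ‖(RCLike.I / 2 : 𝕜) • (star (A : H →L[𝕜] H) - (A : H →L[𝕜] H))‖ ≤ ‖A‖ := by
    rw [norm_smul]
    have := norm_sub_le (star (A : H →L[𝕜] H)) (A : H →L[𝕜] H)
    rw [norm_star] at this
    have h2 : ‖(RCLike.I / 2 : 𝕜)‖ ≤ 1 / 2 := by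
      rw [norm_div, RCLike.norm_ofNat]; linarith
    change _ ≤ ‖(A : H →L[𝕜] H)‖
    nlinarith [norm_nonneg (A : H →L[𝕜] H),
      norm_nonneg (star (A : H →L[𝕜] H) - (A : H →L[𝕜] H))]
  have h1 := hm.norm_inner_le_of_isJordanParts hV₁ hPN hre Δ k
  have h2 := hm.norm_inner_le_of_isJordanParts hV₁ hQR him Δ k
  have e : eval m A Δ = eval m (P - N) Δ + (RCLike.I : 𝕜) • eval m (Q - R) Δ := by
    rw [← eval_smul, ← eval_add, smul_sub, ← add_sub_assoc, ← hA]
  rw [e, add_apply, smul_apply, inner_add_right, inner_smul_right]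
  refine (norm_add_le _ _).trans ?_
  rw [norm_mul]
  have h3 := mul_le_of_le_one_left (norm_nonneg (inner 𝕜 k (eval m (Q - R) Δ k))) hI
  linarith

/-- The integral of a function `∑ gᵢ ⊗ Pᵢ` is controlled by its supremum norm. -/
theorem IsNonnegMeasure.norm_sum_integral_le (hm : IsNonnegMeasure m) (hV₁ : HasJordanParts V₁)
    {ι : Type*} [Fintype ι] (g : ι → X → 𝕜) (P : ι → V₁)
    (hP : ∀ i, (P i : H →L[𝕜] H).IsPositive) (hg : ∀ i, hm.Integrable (g i)) (k : K) {c : ℝ}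
    (hc : 0 ≤ c) (hbound : ∀ x, ‖∑ i, g i x • P i‖ ≤ c) :
    ‖∑ i, ∫ x, g i x ∂((hm (P i) (hP i)).quadMeasure k)‖
      ≤ 2 * c * RCLike.re (inner 𝕜 k (eval m hV₁.one ⟨Set.univ, MeasurableSet.univ⟩ k)) := by
  let μ : ι → Measure X := fun i => (hm (P i) (hP i)).quadMeasure k
  -- Joining the `g i` into one vector-valued map gives simple approximants with level sets common
  -- to all `i`.
  let G : X → ι → 𝕜 := fun x i => g i x
  have hG : Measurable G := measurable_pi_lambda _ fun i => (hg i (P i) (hP i)).1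
  -- The approximants take values only in the range of `G`, or 0. For such a value `y` the operator
  -- `∑ y i • P i` is a value of the original function, or 0, hence of norm at most `c`, even when
  -- the individual `g i` are unbounded.
  let s : Set (ι → 𝕜) := Set.range G ∪ {0}
  let h : ℕ → SimpleFunc X (ι → 𝕜) := fun n =>
    SimpleFunc.approxOn G hG s 0 (by simp [s]) n
  have hint : ∀ i, MeasureTheory.Integrable G (μ i) := fun i => MeasureTheory.Integrable.of_eval fun j =>
    (hm (P i) (hP i)).integrable_quadMeasure (hg j (P i) (hP i)) k
  have hlim : ∀ i, Tendsto (fun n => (h n).integral (μ i) i) atTop (𝓝 (∫ x, g i x ∂(μ i))) := by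
    intro i
    have h1 := tendsto_integral_approxOn_of_measurable_of_range_subset hG (hint i) s subset_rfl
    have h2 := (ContinuousLinearMap.proj (R := ℝ) (φ := fun _ : ι => 𝕜) i).integral_comp_comm
      (hint i)
    have h3 := ((continuous_apply i).tendsto _).comp h1
    change Tendsto _ _ (𝓝 ((ContinuousLinearMap.proj (R := ℝ) (φ := fun _ : ι => 𝕜) i)
      (∫ x, G x ∂(μ i)))) at h3
    rw [← h2] at h3
    exact h3
  refine le_of_tendsto (tendsto_finsetSum _ fun i _ => hlim i).norm
    (Eventually.of_forall fun n => ?_)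
  let D : (ι → 𝕜) → MeasSet X := fun y => ⟨h n ⁻¹' {y}, (h n).measurableSet_preimage _⟩
  have e : ∑ i, (h n).integral (μ i) i
      = ∑ y ∈ (h n).range, inner 𝕜 k (eval m (∑ i, y i • P i) (D y) k) := by
    have e1 : ∀ i, (h n).integral (μ i) i
        = ∑ y ∈ (h n).range, inner 𝕜 k (eval m (y i • P i) (D y) k) := by
      intro i
      rw [SimpleFunc.integral_eq, Finset.sum_apply]
      refine Finset.sum_congr rfl fun y _ => ?_
      rw [eval_smul, smul_apply, inner_smul_right,
        inner_self_eq_re_of_isPositive ((hm (P i) (hP i)).isPositive (D y)) k,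
        ← (hm (P i) (hP i)).quadMeasure_real k (D y), Pi.smul_apply,
        RCLike.real_smul_eq_coe_mul, mul_comm]
    simp only [e1]
    rw [Finset.sum_comm]
    refine Finset.sum_congr rfl fun y _ => ?_
    rw [eval_sum, sum_apply, inner_sum]
  rw [e]
  have hone := hm hV₁.one hV₁.isPositive_one
  -- The level sets partition `X`, so the bounds on them add up to the total mass.
  have hsum : ∑ y ∈ (h n).range, RCLike.re (inner 𝕜 k (eval m hV₁.one (D y) k))
      = RCLike.re (inner 𝕜 k (eval m hV₁.one ⟨Set.univ, MeasurableSet.univ⟩ k)) := by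
    have := hone.isFiniteMeasure_quadMeasure k
    rw [← hone.quadMeasure_real k ⟨Set.univ, MeasurableSet.univ⟩]
    simp only [← hone.quadMeasure_real k]
    change _ = (hone.quadMeasure k).real Set.univ
    rw [measureReal_def, ← SimpleFunc.sum_range_measure_preimage_singleton (h n),
      ENNReal.toReal_sum fun y _ => measure_ne_top _ _]
    rfl
  rw [← hsum, Finset.mul_sum]
  refine norm_sum_le_of_le _ fun y hy => ?_
  refine (hm.norm_inner_le hV₁ _ (D y) k).trans ?_
  refine mul_le_mul_of_nonneg_right ?_ (hone.inner_nonneg (D y) k)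
  refine mul_le_mul_of_nonneg_left ?_ two_pos.le
  obtain ⟨x, rfl⟩ := SimpleFunc.mem_range.1 hy
  rcases SimpleFunc.approxOn_mem hG (s := s) (y₀ := 0) (by simp [s]) n x with ⟨x', hx'⟩ | h0
  · change G x' = h n x at hx'
    rw [← hx']
    exact hbound x'
  · have h0' : h n x = 0 := h0
    rw [h0']
    simpa using hc

end Uniqueness

/-! ### Uniqueness of the representing measure and the final assembly. -/

section Main

set_option maxSynthPendingDepth 3

variable {𝕜 X H K : Type*} [RCLike 𝕜]
  [NormedAddCommGroup H] [InnerProductSpace 𝕜 H] [NormedAddCommGroup K] [InnerProductSpace 𝕜 K]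
  {V₁ : Submodule 𝕜 (H →L[𝕜] H)} {V₂ : Submodule 𝕜 (K →L[𝕜] K)}
  [MeasurableSpace X] {m : MeasSet X → (V₁ →L[𝕜] V₂)}

theorem IsNonnegMeasure.integrable_const_mul (hm : IsNonnegMeasure m) {f : X → 𝕜}
    (hf : hm.Integrable f) (c : 𝕜) : hm.Integrable fun x => c * f x := by
  intro A hA
  obtain ⟨hfm, C, hC⟩ := hf A hA
  refine ⟨hfm.const_mul c, ‖c‖ * C, fun k => ?_⟩
  simp only [norm_mul, ENNReal.ofReal_mul (norm_nonneg c)]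
  rw [lintegral_const_mul' _ _ ENNReal.ofReal_ne_top, mul_assoc, ENNReal.ofReal_mul (norm_nonneg c)]
  gcongr
  exact hC k

variable [CompleteSpace H]

/-- The supremum bound applied to `G - f ⊗ A`, expanded into tensors with positive operators. -/
theorem IsNonnegMeasure.norm_inner_sub_integral_le (hm : IsNonnegMeasure m)
    (hV₁ : HasJordanParts V₁) {G : X → V₁} {S : K →L[𝕜] K} (hGS : hm.HasTensorIntegral G S)
    {f : X → 𝕜} (hf : hm.Integrable f) {A : V₁} (hA : (A : H →L[𝕜] H).IsPositive) (k : K) {c : ℝ}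
    (hc : 0 ≤ c) (hbound : ∀ x, ‖G x - f x • A‖ ≤ c) :
    ‖inner 𝕜 k (S k) - ∫ x, f x ∂((hm A hA).quadMeasure k)‖
      ≤ 2 * c * RCLike.re (inner 𝕜 k (eval m hV₁.one ⟨Set.univ, MeasurableSet.univ⟩ k)) := by
  obtain ⟨n, g, B, T, hG, hT, rfl⟩ := hGS
  choose hg P N Q R hre him TP TN TQ TR hP hN hQ hR hTeq using hT
  let coef : Fin 4 → 𝕜 := ![1, -1, RCLike.I, -RCLike.I]
  -- The index `none` carries `-f ⊗ A`; each pair carries one of the four Jordan parts of some `B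
  -- j`.
  let W : Option (Fin n × Fin 4) → V₁ := fun o =>
    o.elim A fun p => (![P p.1, N p.1, Q p.1, R p.1] : Fin 4 → V₁) p.2
  let w : Option (Fin n × Fin 4) → X → 𝕜 := fun o =>
    o.elim (fun x => (-1) * f x) fun p x => coef p.2 * g p.1 x
  have hW : ∀ o, (W o : H →L[𝕜] H).IsPositive := by
    rintro (_ | ⟨j, a⟩)
    · exact hA
    · fin_cases a
      · exact (hre j).pos
      · exact (hre j).neg
      · exact (him j).pos
      · exact (him j).neg
  have hw : ∀ o, hm.Integrable (w o) := by
    rintro (_ | ⟨j, a⟩)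
    · exact hm.integrable_const_mul hf _
    · exact hm.integrable_const_mul (hg j) _
  -- The parts in `hre`, `him` need not be matched with those of `exists_parts`: only the
  -- differences enter, and these are the real and imaginary parts of `B j`.
  have hB : ∀ j, B j = P j - N j + (RCLike.I : 𝕜) • Q j - (RCLike.I : 𝕜) • R j := by
    intro j
    obtain ⟨P', N', Q', R', hPN, hQR, e⟩ := hV₁.exists_parts (B j)
    have e1 : P' - N' = P j - N j := Subtype.ext (hPN.sub_eq.symm.trans (hre j).sub_eq)
    have e2 : Q' - R' = Q j - R j := Subtype.ext (hQR.sub_eq.symm.trans (him j).sub_eq)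
    rw [add_sub_assoc, ← smul_sub] at e ⊢
    rw [e, e1, e2]
  have key := hm.norm_sum_integral_le hV₁ w W hW hw k hc fun x => by
    refine le_trans (le_of_eq ?_) (hbound x)
    congr 1
    rw [Fintype.sum_option, Fintype.sum_prod_type]
    simp only [Fin.sum_univ_four]
    rw [hG x]
    have : ∀ j, g j x • B j = (1 * g j x) • P j + (-1 * g j x) • N j
        + (RCLike.I * g j x) • Q j + (-RCLike.I * g j x) • R j := by
      intro j
      rw [hB j]
      module
    simp only [this]
    change (-1 * f x) • A + ∑ j, ((1 * g j x) • P j + (-1 * g j x) • N j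
        + (RCLike.I * g j x) • Q j + (-RCLike.I * g j x) • R j) = _
    rw [neg_one_mul, neg_smul]
    abel
  refine le_trans (le_of_eq ?_) key
  congr 1
  rw [Fintype.sum_option, Fintype.sum_prod_type]
  simp only [Fin.sum_univ_four]
  have e0 : ∫ x, w none x ∂((hm (W none) (hW none)).quadMeasure k)
      = -∫ x, f x ∂((hm A hA).quadMeasure k) := by
    change ∫ x, (-1) * f x ∂((hm A hA).quadMeasure k) = _
    rw [integral_const_mul, neg_one_mul]
  have e1 : ∀ j, inner 𝕜 k (T j k)
      = ∫ x, w (some (j, 0)) x ∂((hm _ (hW (some (j, 0)))).quadMeasure k)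
      + ∫ x, w (some (j, 1)) x ∂((hm _ (hW (some (j, 1)))).quadMeasure k)
      + ∫ x, w (some (j, 2)) x ∂((hm _ (hW (some (j, 2)))).quadMeasure k)
      + ∫ x, w (some (j, 3)) x ∂((hm _ (hW (some (j, 3)))).quadMeasure k) := by
    intro j
    change _ = ∫ x, 1 * g j x ∂((hm (P j) (hre j).pos).quadMeasure k)
      + ∫ x, (-1) * g j x ∂((hm (N j) (hre j).neg).quadMeasure k)
      + ∫ x, RCLike.I * g j x ∂((hm (Q j) (him j).pos).quadMeasure k)
      + ∫ x, (-RCLike.I) * g j x ∂((hm (R j) (him j).neg).quadMeasure k)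
    simp only [integral_const_mul]
    rw [← (hm _ (hre j).pos).inner_self_of_hasIntegral (hP j),
      ← (hm _ (hre j).neg).inner_self_of_hasIntegral (hN j),
      ← (hm _ (him j).pos).inner_self_of_hasIntegral (hQ j),
      ← (hm _ (him j).neg).inner_self_of_hasIntegral (hR j),
      hTeq j]
    simp only [sub_apply, add_apply, smul_apply, inner_sub_right, inner_add_right,
      inner_smul_right]
    ring
  rw [e0, sum_apply, inner_sum]
  simp only [e1]
  ring

variable [TopologicalSpace X] [BorelSpace X]
  {L : C₀(X, V₁) →L[𝕜] V₂}

/-- The sequence approximating `f ⊗ A` in `HasIntegral` is arbitrary; the supremum bound forces its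
integrals to converge to the integral of `f` as well. -/
theorem IsNonnegMeasure.integral_quadMeasure_eq (hm : IsNonnegMeasure m)
    (hV₁ : HasJordanParts V₁) (hL : ∀ F : C₀(X, V₁), hm.HasIntegral F (L F : K →L[𝕜] K))
    {A : V₁} (hA : (A : H →L[𝕜] H).IsPositive) (k : K) (f : C_c(X, ℝ)) :
    ∫ x, ((f x : ℝ) : 𝕜) ∂((hm A hA).quadMeasure k) = inner 𝕜 k (tensorValue L f A k) := by
  obtain ⟨G, S, hGS, hG, hS⟩ := hL (tensor 𝕜 f A)
  have hf := integrable_compactlySupported_ofReal hm f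
  set M := RCLike.re (inner 𝕜 k (eval m hV₁.one ⟨Set.univ, MeasurableSet.univ⟩ k)) with hM
  have hlim1 : Tendsto (fun i => inner 𝕜 k (S i k)) atTop
      (𝓝 (inner 𝕜 k (tensorValue L f A k))) := by
    have h : Continuous fun T : K →L[𝕜] K => inner 𝕜 k (T k) := by fun_prop
    exact (h.tendsto _).comp hS
  have hlim2 : Tendsto (fun i => inner 𝕜 k (S i k)) atTop
      (𝓝 (∫ x, ((f x : ℝ) : 𝕜) ∂((hm A hA).quadMeasure k))) := by
    rw [Metric.tendsto_nhds]
    intro ε hε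
    have hM0 : 0 ≤ M := (hm _ hV₁.isPositive_one).inner_nonneg _ k
    -- `M + 1` rather than `M`, which may be zero.
    have hδ : 0 < ε / (2 * (M + 1)) := by positivity
    refine (Metric.tendstoUniformly_iff.1 hG _ hδ).mono fun i hi => ?_
    rw [dist_eq_norm]
    refine (hm.norm_inner_sub_integral_le hV₁ (hGS i) hf hA k hδ.le fun x => ?_).trans_lt ?_
    · have := (hi x).le
      rw [dist_comm, dist_eq_norm] at this
      exact this
    · rw [← hM]
      have : 2 * (ε / (2 * (M + 1))) * M = ε * (M / (M + 1)) := by field_simp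
      rw [this]
      have h2 : M / (M + 1) < 1 := by rw [div_lt_one (by linarith)]; linarith
      nlinarith
  exact tendsto_nhds_unique hlim2 hlim1

variable [T2Space X] [LocallyCompactSpace X] [CompleteSpace K]

/-- Finite regular measures that agree on `C_c(X, ℝ)` are equal; polarization then recovers the
operator from its quadratic form. -/
theorem IsRepresentingMeasure.eval_unique {m' : MeasSet X → (V₁ →L[𝕜] V₂)}
    (hV₁ : HasJordanParts V₁) (h : IsRepresentingMeasure L m) (h' : IsRepresentingMeasure L m')
    {A : V₁} (hA : (A : H →L[𝕜] H).IsPositive) (Δ : MeasSet X) : eval m A Δ = eval m' A Δ := by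
  obtain ⟨hr, hm, hi⟩ := h
  obtain ⟨hr', hm', hi'⟩ := h'
  have hq : ∀ k, (hm A hA).quadMeasure k = (hm' A hA).quadMeasure k := by
    intro k
    have := (hm A hA).isFiniteMeasure_quadMeasure k
    have := (hm' A hA).isFiniteMeasure_quadMeasure k
    have := ((hm A hA).isCompactOpenRegular_quadMeasure (hr A hA k k)).regular
    have := ((hm' A hA).isCompactOpenRegular_quadMeasure (hr' A hA k k)).regular
    refine Measure.ext_of_integral_eq_on_compactlySupported fun f => ?_
    have e := (hm.integral_quadMeasure_eq hV₁ hi hA k f).trans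
      (hm'.integral_quadMeasure_eq hV₁ hi' hA k f).symm
    rw [integral_ofReal, integral_ofReal] at e
    exact RCLike.ofReal_injective e
  have hre : ∀ k, RCLike.re (inner 𝕜 k (eval m A Δ k)) = RCLike.re (inner 𝕜 k (eval m' A Δ k)) := by
    intro k
    rw [← (hm A hA).quadMeasure_real, ← (hm' A hA).quadMeasure_real, hq]
  ext x
  refine ext_inner_left 𝕜 fun y => ?_
  rw [inner_eq_polarization ((hm A hA).isPositive Δ).isSelfAdjoint,
    inner_eq_polarization ((hm' A hA).isPositive Δ).isSelfAdjoint]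
  simp only [hre]

theorem IsRepresentingMeasure.unique {m' : MeasSet X → (V₁ →L[𝕜] V₂)}
    (hV₁ : HasJordanParts V₁) (h : IsRepresentingMeasure L m) (h' : IsRepresentingMeasure L m') :
    m = m' := by
  funext Δ
  refine ContinuousLinearMap.ext fun A => Subtype.ext ?_
  obtain ⟨P, N, Q, R, hPN, hQR, hA⟩ := hV₁.exists_parts A
  change eval m A Δ = eval m' A Δ
  rw [hA]
  simp only [eval_sub, eval_add, eval_smul]
  rw [h.eval_unique hV₁ h' hPN.pos, h.eval_unique hV₁ h' hPN.neg, h.eval_unique hV₁ h' hQR.pos,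
    h.eval_unique hV₁ h' hQR.neg]

theorem existsUnique_isRepresentingMeasure (hV₁ : HasJordanParts V₁)
    (hV₂ : IsWeaklyClosed (V₂ : Set (K →L[𝕜] K))) (hL : IsPositiveMap L) :
    ∃! m : MeasSet X → (V₁ →L[𝕜] V₂), IsRepresentingMeasure L m := by
  obtain ⟨m, hm⟩ := exists_isLimitMeasure hV₁ hV₂ hL
  have h := hm.isRepresentingMeasure hL hV₁
  exact ⟨m, h, fun m' h' => h'.unique hV₁ h⟩

end Main

end OperatorMeasure

theorem mainTheorem4 {X : Type*} [TopologicalSpace X] [T2Space X] [LocallyCompactSpace X]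
    [MeasurableSpace X] [BorelSpace X] :
    (∀ {H K : Type*} [NormedAddCommGroup H] [InnerProductSpace ℝ H] [CompleteSpace H]
      [NormedAddCommGroup K] [InnerProductSpace ℝ K] [CompleteSpace K]
      (W₁ : RealVonNeumannAlgebra H) (W₂ : RealVonNeumannAlgebra K)
      (L : C₀(X, W₁.hermitian) →L[ℝ] W₂.hermitian), OperatorMeasure.IsPositiveMap L →
      ∃! m : MeasSet X → (W₁.hermitian →L[ℝ] W₂.hermitian),
        OperatorMeasure.IsRepresentingMeasure L m) ∧
    (∀ {H K : Type*} [NormedAddCommGroup H] [InnerProductSpace ℂ H] [CompleteSpace H]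
      [NormedAddCommGroup K] [InnerProductSpace ℂ K] [CompleteSpace K]
      (W₁ : VonNeumannAlgebra H) (W₂ : VonNeumannAlgebra K)
      (L : C₀(X, W₁.space) →L[ℂ] W₂.space), OperatorMeasure.IsPositiveMap L →
      ∃! m : MeasSet X → (W₁.space →L[ℂ] W₂.space),
        OperatorMeasure.IsRepresentingMeasure L m) :=
  ⟨fun W₁ W₂ _ hL => OperatorMeasure.existsUnique_isRepresentingMeasure
      (OperatorMeasure.hasJordanParts_hermitian W₁) (OperatorMeasure.isWeaklyClosed_hermitian W₂) hL,
    fun W₁ W₂ _ hL => OperatorMeasure.existsUnique_isRepresentingMeasure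
      (OperatorMeasure.hasJordanParts_space W₁) (OperatorMeasure.isWeaklyClosed_space W₂) hL⟩
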